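/- For $x\in\mathbb R$, $\rho>-1$, $\beta\in\mathbb R$ let $W(x;\rho;\beta)=\sum_{k=0}^{\infty}\frac{x^k}{k!\,\Gamma(\rho k+\beta)}$ be the Wright function (with $1/\Gamma=0$ at the poles of $\Gamma$) and, for $0<\rho<1$, let $M_\rho(x)=W(-x;-\rho;1-\rho)$ be the Mainardi function. For a function $f$ of time put ${}_0I^{\beta}f(t)=\frac1{\Gamma(\beta)}\int_0^t\frac{f(\tau)}{(t-\tau)^{1-\beta}}\,d\tau$ $(\beta>0)$, and for $0<\gamma<1$ let ${}^{C}D^{\gamma}f={}_0I^{1-\gamma}f'$ and ${}^{RL}D^{\gamma}f=\frac{d}{dt}\,{}_0I^{1-\gamma}f$ be the Caputo and Riemann--Liouville derivatives. For $0<\alpha<1$ and $T>0$ consider, for a temperature $u$ and a free boundary $s$, the conditions $$s(0)=0,\qquad u(0,t)=1,\quad u(s(t),t)=0\quad(0<t\le T)$$ together with either (P1) ${}^{C}D^{\alpha}_t u=u_{xx}$ for $0<x<s(t)$, $0<t<T$, and ${}^{C}D^{\alpha}s(t)=-u_x(s(t),t)$ for $0<t\le T$; or (P2) $u_t=\frac{\partial}{\partial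 x}\left({}^{RL}D^{1-\alpha}_t u_x\right)$ for $0<x<s(t)$, $0<t<T$, and $s'(t)=-\lim_{x\to s(t)^-}{}^{RL}D^{1-\alpha}_t u_x(x,t)$ for $0<t\le T$. Here $u$ is continuous on $\{0\le x\le s(t),\ 0<t\le T\}$, $s$ is continuous on $[0,T]$ and positive on $(0,T]$, and the fractional derivatives of $u$ in time are taken over $(0,t)$ at fixed $x$, so that $u$ is also given to the right of the free boundary. For $\zeta>0$ put $$u_\zeta(x,t)=1-\frac{1-W\left(-x\,t^{-\alpha/2};-\frac\alpha2;1\right)}{1-W\left(-2\zeta;-\frac\alpha2;1\right)},\qquad s_\zeta(t)=2\zeta\,t^{\alpha/2}.$$ **Theorem.** Let $\alpha\in(0,1)$. The equation $$2x\left[1-W\left(-2x;-\tfrac\alpha2;1\right)\right]=M_{\alpha/2}(2x)\,\frac{\Gamma(1-\alpha/2)}{\Gamma(1+\alpha/2)},\qquad x>0,$$ has a unique solution $\eta_\alpha$, and the equation $$2x\left[1-W\left(-2x;-\tfrac\alpha2;1\right)\right]=2x\,W\left(-2x;-\tfrac\alpha2;1\right)+W\left(-2x;-\tfrac\alpha2;1+\tfrac\alpha2\right),\qquad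 x>0,$$ has a unique solution $\xi_\alpha$. For every $T>0$ the pair $(u_{\eta_\alpha},s_{\eta_\alpha})$ is a solution of (P1) and the pair $(u_{\xi_\alpha},s_{\xi_\alpha})$ is a solution of (P2). These two explicit solutions are different: $\eta_\alpha\ne\xi_\alpha$; hence $s_{\eta_\alpha}(t)\ne s_{\xi_\alpha}(t)$ for all $t>0$, and $u_{\eta_\alpha}(x,t)\ne u_{\xi_\alpha}(x,t)$ for all $x>0$, $t>0$. -/

import Mathlib

open Set Filter Topology

namespace FracStefan

noncomputable section

/-- The Wright function `W(x; ρ; β) = ∑ x ^ k / (k! Γ(ρ k + β))` (used for `ρ > -1`, where the series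
converges absolutely). At a pole of `Γ` Mathlib's `Real.Gamma` is `0`, so that the term is `0`, in
agreement with the entire function `1 / Γ`. -/
def wright (x ρ β : ℝ) : ℝ :=
  ∑' k : ℕ, x ^ k / ((k.factorial : ℝ) * Real.Gamma (ρ * k + β))

/-- The Mainardi function `M_ρ(x) = W(-x; -ρ; 1 - ρ)`. -/
def mainardi (ρ x : ℝ) : ℝ := wright (-x) (-ρ) (1 - ρ)

/-- Integrability of the integrand of the Riemann–Liouville integral of order `β` on `(0, t)`. -/
def RLIntegrable (β : ℝ) (f : ℝ → ℝ) (t : ℝ) : Prop :=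
  IntervalIntegrable (fun τ => f τ / (t - τ) ^ (1 - β)) MeasureTheory.volume 0 t

/-- The Riemann–Liouville integral `(1 / Γ(β)) ∫₀ᵗ f(τ) / (t - τ) ^ (1 - β) dτ`. -/
def rlIntegral (β : ℝ) (f : ℝ → ℝ) (t : ℝ) : ℝ :=
  1 / Real.Gamma β * ∫ τ in (0 : ℝ)..t, f τ / (t - τ) ^ (1 - β)

/-- The Caputo derivative of order `α` of `f` exists at `t` and equals `d`:
`d = (1 / Γ(1 - α)) ∫₀ᵗ f'(τ) / (t - τ) ^ α dτ`. -/
def HasCaputoDerivAt (α : ℝ) (f : ℝ → ℝ) (d t : ℝ) : Prop :=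
  (∀ τ ∈ Ioo 0 t, DifferentiableAt ℝ f τ) ∧
  RLIntegrable (1 - α) (deriv f) t ∧
  rlIntegral (1 - α) (deriv f) t = d

/-- The Riemann–Liouville derivative of order `γ` of `f`, `f` being considered on `(0, T]`, exists at
`t` and equals `d`: `d` is the derivative at `t` of `y ↦ (1 / Γ(1 - γ)) ∫₀ʸ f(τ) / (y - τ) ^ γ dτ`
(the left derivative if `t = T`). -/
def HasRLDerivAt (γ T : ℝ) (f : ℝ → ℝ) (d t : ℝ) : Prop :=
  (∀ᶠ y in 𝓝[Icc 0 T] t, RLIntegrable (1 - γ) f y) ∧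
  HasDerivWithinAt (rlIntegral (1 - γ) f) d (Icc 0 T) t

/-- What the two Stefan problems have in common: `s(0) = 0`, the front is continuous and positive
for positive times, the temperature `u` (as a function of `x`, `t`) is continuous on
`0 ≤ x ≤ s(t)`, `0 < t ≤ T`, and `u(0, t) = 1`, `u(s(t), t) = 0` for `0 < t ≤ T`. As the fractional
operators integrate over the whole time interval `(0, t)` at fixed `x`, the temperature is a
function also to the right of the front. -/
structure IsStefanPair (T : ℝ) (u : ℝ → ℝ → ℝ) (s : ℝ → ℝ) : Prop where
  front_continuous : ContinuousOn s (Icc 0 T)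
  front_zero : s 0 = 0
  front_pos : ∀ t ∈ Ioc 0 T, 0 < s t
  temp_continuous : ContinuousOn (fun p : ℝ × ℝ => u p.1 p.2)
    {p : ℝ × ℝ | p.2 ∈ Ioc 0 T ∧ p.1 ∈ Icc 0 (s p.2)}
  temp_fixed : ∀ t ∈ Ioc 0 T, u 0 t = 1
  temp_front : ∀ t ∈ Ioc 0 T, u (s t) t = 0

/-- `(u, s)` solves the Caputo fractional one-phase Stefan problem on `(0, T]`. -/
structure SolvesCaputoStefan (α T : ℝ) (u : ℝ → ℝ → ℝ) (s : ℝ → ℝ) : Prop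
    extends IsStefanPair T u s where
  /-- `D^α u = u_xx` for `0 < x < s(t)`, `0 < t < T`. -/
  diffusion : ∀ t ∈ Ioo 0 T, ∀ x ∈ Ioo 0 (s t), ∃ d : ℝ,
    HasCaputoDerivAt α (fun τ => u x τ) d t ∧
    (∀ y ∈ Ioo 0 (s t), DifferentiableAt ℝ (fun z => u z t) y) ∧
    HasDerivAt (fun y => deriv (fun z => u z t) y) d x
  /-- `D^α s(t) = -u_x(s(t), t)` for `0 < t ≤ T`. -/
  stefan : ∀ t ∈ Ioc 0 T, ∃ d : ℝ,
    HasCaputoDerivAt α s d t ∧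
    HasDerivWithinAt (fun z => u z t) (-d) (Icc 0 (s t)) (s t)

/-- `(u, s)` solves the Riemann–Liouville flux fractional one-phase Stefan problem on `(0, T]`. -/
structure SolvesRLStefan (α T : ℝ) (u : ℝ → ℝ → ℝ) (s : ℝ → ℝ) : Prop
    extends IsStefanPair T u s where
  /-- The Riemann–Liouville derivative `q(x, t)` of order `1 - α` in time of `u_x` exists for
  `0 < x < s(t)`, `0 < t ≤ T`, and satisfies `u_t = q_x` for `0 < x < s(t)`, `0 < t < T` and
  `s'(t) = - lim q(x, t)` as `x → s(t)⁻` for `0 < t ≤ T`. -/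
  flux : ∃ q : ℝ → ℝ → ℝ,
    (∀ t ∈ Ioc 0 T, ∀ x ∈ Ioo 0 (s t),
      (∀ τ ∈ Ioc 0 T, DifferentiableAt ℝ (fun z => u z τ) x) ∧
      HasRLDerivAt (1 - α) T (fun τ => deriv (fun z => u z τ) x) (q x t) t) ∧
    (∀ t ∈ Ioo 0 T, ∀ x ∈ Ioo 0 (s t), ∃ d : ℝ,
      HasDerivAt (fun τ => u x τ) d t ∧ HasDerivAt (fun y => q y t) d x) ∧
    (∀ t ∈ Ioc 0 T, ∃ v : ℝ,
      HasDerivWithinAt s v (Icc 0 T) t ∧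
      Tendsto (fun x => q x t) (𝓝[<] (s t)) (𝓝 (-v)))

/-- The similarity temperature with parameter `ζ`. -/
def simTemp (α ζ x t : ℝ) : ℝ :=
  1 - 1 / (1 - wright (-2 * ζ) (-(α / 2)) 1) * (1 - wright (-(x / t ^ (α / 2))) (-(α / 2)) 1)

/-- The similarity free boundary `2 ζ t ^ (α / 2)`. -/
def simFront (α ζ t : ℝ) : ℝ := 2 * ζ * t ^ (α / 2)

/-- `x` is a positive solution of the equation for the parameter `η_α`. -/
def IsEtaRoot (α x : ℝ) : Prop :=
  0 < x ∧
  2 * x * (1 - wright (-2 * x) (-(α / 2)) 1) =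
    mainardi (α / 2) (2 * x) * (Real.Gamma (1 - α / 2) / Real.Gamma (1 + α / 2))

/-- `x` is a positive solution of the equation for the parameter `ξ_α`. -/
def IsXiRoot (α x : ℝ) : Prop :=
  0 < x ∧
  2 * x * (1 - wright (-2 * x) (-(α / 2)) 1) =
    2 * x * wright (-2 * x) (-(α / 2)) 1 + wright (-2 * x) (-(α / 2)) (1 + α / 2)

end

end FracStefan

/-!
Put `ρ = α / 2 ∈ (0, 1/2)`, `W_β(y) = W(-y; -ρ; β)` and `φ_β(x, t) = t ^ (β - 1) W_β(x t ^ (-ρ))`.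
Formally `φ_β(x, ·)` is the inverse Laplace transform of `s ^ (-β) exp(-x s ^ ρ)`, so that
`∂ₜ φ_β = φ_{β-1}`, `∂ₓ φ_β = -φ_{β-ρ}` and the fractional integral of order `γ` of `φ_β` is
`φ_{β+γ}`. As `u_ζ` is an affine function of `φ_1`, both Stefan problems reduce to these three rules
and to the equation which the front condition imposes on `ζ`.

The first two rules are the termwise derivative of the series (`hasDerivAt_wrightNeg`) and the
contiguous relation `wrightNeg_sub_one`. The third cannot be read off the series, whose terms are
not integrable at `t = 0`. For `β < 1` the series is the jump across the negative axis of a Hankel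
integral (`hasSum_wrightTerm_of_lt_one`). Because `ρ < 1/2`, its factors `exp(-y r ^ ρ e^{∓ iπρ})`
decay in `y`, which gives a decay estimate and the Mellin transform `Γ(z) / Γ(β + ρ z)` of `W_β`
(`exists_abs_wrightNeg_le`, `hasMellin_wrightNeg`). A beta
integral then yields the Mellin transform of the fractional integral (`hasMellin_fracKernel`), and
Mellin inversion concludes (`fracKernel_zero_div_Gamma`, `fracKernel_div_Gamma_eq`).

The equations for `η` and `ξ` are both of the form `y (1 - W_1(y)) = R(y)` with `y = 2 x`, where
`W_1' = -W_{1-ρ}` and `W_{1-ρ}` is the Mainardi function. Once the latter is known to be positive and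
nonincreasing, the left side increases strictly from `0` to `∞` and `R` is nonincreasing with
`R(0) > 0`, hence there is exactly one root (`existsUnique_stefanLHS_eq`). Positivity comes from
`φ_0 ≥ 0`: the relation `t φ_0 = ρ x I^{1-ρ} φ_0` gives the Laplace transform of `φ_0` as a multiple
of `exp(-s ^ ρ)` and a recursion with nonnegative coefficients for its derivatives
(`laplaceMoment_succ`), so that this transform is completely monotone up to sign, and a Post–Widder
argument (`nonneg_of_laplace_moments_nonneg`) recovers the sign of `φ_0`. The sign is positive
because `φ_0 > 0` for large times. All the other kernels are fractional integrals of `φ_0`.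

Finally, a common root would force `Γ(1-ρ) W_{1-ρ}(y) = Γ(ρ) W_ρ(y)`. The two sides are integrals of
`φ_0` over `(0, 1)` with the weights `(1 - τ) ^ (-ρ) < (1 - τ) ^ (ρ - 1)`, so they are never equal
(`Gamma_mul_mainardi_lt`).
-/

namespace FracStefan

open MeasureTheory

/-! ### The Wright series of negative parameter -/

/-- The function `y ↦ W(-y; -ρ; β)`, through which all the Wright functions of the problem enter. -/
noncomputable def wrightNeg (ρ β y : ℝ) : ℝ := wright (-y) (-ρ) β

/-- The terms of the series of `W(-y; -ρ; β)`. -/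
noncomputable def wrightTerm (ρ β y : ℝ) (k : ℕ) : ℝ :=
  (-y) ^ k / ((k.factorial : ℝ) * Real.Gamma (-ρ * k + β))

/-- The Laplace-type integral `∫₀^∞ e⁻ʳ r^(-β) exp(-w r^ρ) dr`. Evaluated on the two rays
`w = y exp(∓ iπρ)` it gives the contributions of the two sides of the branch cut to the Hankel
contour integral of the Wright function. -/
noncomputable def cutIntegral (ρ β : ℝ) (w : ℂ) : ℂ :=
  ∫ r in Ioi (0 : ℝ), ((Real.exp (-r) * r ^ (-β) : ℝ) : ℂ) * Complex.exp (-(w * (r ^ ρ : ℝ)))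

lemma integrableOn_exp_neg_mul_rpow_mul_exp {ρ β : ℝ} (hρ0 : 0 < ρ) (hρ : ρ < 1 / 2) (hβ : β < 1)
    (A : ℝ) (hA : 0 ≤ A) :
    IntegrableOn (fun r : ℝ => Real.exp (-r) * r ^ (-β) * Real.exp (A * r ^ ρ)) (Ioi 0) := by
  have h1 : IntegrableOn (fun r : ℝ => Real.exp (A + A ^ 2 / 2) *
      (r ^ (-β) * Real.exp (-(1 / 2) * r ^ (1 : ℝ)))) (Ioi 0) :=
    (integrableOn_rpow_mul_exp_neg_mul_rpow (by linarith) one_pos (by norm_num)).const_mul _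
  refine Integrable.mono' h1 (by fun_prop) ?_
  filter_upwards [ae_restrict_mem measurableSet_Ioi] with r hr
  have hr : 0 < r := hr
  rw [Real.norm_of_nonneg (by positivity), Real.rpow_one]
  have h2 : r ^ ρ ≤ 1 + Real.sqrt r := by
    rcases le_total r 1 with h | h
    · have := Real.rpow_le_one hr.le h hρ0.le
      have := Real.sqrt_nonneg r
      linarith
    · have := Real.rpow_le_rpow_of_exponent_le h hρ.le
      rw [← Real.sqrt_eq_rpow] at this
      linarith
  have h3 : A * r ^ ρ ≤ A + A ^ 2 / 2 + r / 2 := by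
    have := mul_le_mul_of_nonneg_left h2 hA
    nlinarith [sq_nonneg (A - Real.sqrt r), Real.sq_sqrt hr.le]
  have h4 : Real.exp (-r) * Real.exp (A * r ^ ρ) ≤
      Real.exp (A + A ^ 2 / 2) * Real.exp (-(1 / 2) * r) := by
    rw [← Real.exp_add, ← Real.exp_add, Real.exp_le_exp]
    linarith
  calc _ = (Real.exp (-r) * Real.exp (A * r ^ ρ)) * r ^ (-β) := by ring
    _ ≤ (Real.exp (A + A ^ 2 / 2) * Real.exp (-(1 / 2) * r)) * r ^ (-β) := by gcongr
    _ = _ := by ring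

/-- Expansion of the exponential under the integral sign; the series converges since `ρ < 1`. -/
lemma hasSum_cutIntegral {ρ β : ℝ} (hρ0 : 0 < ρ) (hρ : ρ < 1 / 2) (hβ : β < 1) (w : ℂ) :
    HasSum (fun k : ℕ => (-w) ^ k / (k.factorial : ℂ) * (Real.Gamma (1 - β + ρ * k) : ℂ))
      (cutIntegral ρ β w) := by
  have key : HasSum (fun k : ℕ => ∫ r in Ioi (0 : ℝ), ((Real.exp (-r) * r ^ (-β) : ℝ) : ℂ) *
      ((-(w * (r ^ ρ : ℝ))) ^ k / (k.factorial : ℂ))) (cutIntegral ρ β w) := by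
    refine hasSum_integral_of_dominated_convergence
      (fun k r => (Real.exp (-r) * r ^ (-β)) * ((‖w‖ * |r ^ ρ|) ^ k / (k.factorial : ℝ)))
      (fun k => by fun_prop) ?_ ?_ ?_ ?_
    · intro k
      filter_upwards [ae_restrict_mem measurableSet_Ioi] with r hr
      have hr : 0 < r := hr
      have h0 : 0 ≤ Real.exp (-r) * r ^ (-β) := by positivity
      rw [norm_mul, Complex.norm_real, Real.norm_of_nonneg h0, norm_div, norm_pow, norm_neg,
        norm_mul, Complex.norm_real, Complex.norm_natCast, Real.norm_eq_abs]
    · filter_upwards with r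
      exact (Real.summable_pow_div_factorial _).mul_left _
    · refine (integrableOn_exp_neg_mul_rpow_mul_exp hρ0 hρ hβ ‖w‖ (norm_nonneg w)).congr ?_
      filter_upwards [ae_restrict_mem measurableSet_Ioi] with r hr
      have hr : 0 < r := hr
      rw [tsum_mul_left, Real.exp_eq_exp_ℝ, NormedSpace.exp_eq_tsum_div (𝔸 := ℝ),
        abs_of_nonneg (by positivity : (0:ℝ) ≤ r ^ ρ)]
    · filter_upwards with r
      refine HasSum.mul_left _ ?_
      rw [Complex.exp_eq_exp_ℂ]
      exact NormedSpace.expSeries_div_hasSum_exp _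
  refine key.congr_fun fun k => ?_
  have h1 : (0 : ℝ) < 1 - β + ρ * k := by
    have : 0 ≤ ρ * k := by positivity
    linarith
  rw [Real.Gamma_eq_integral h1, ← integral_complex_ofReal, ← integral_const_mul]
  refine setIntegral_congr_fun measurableSet_Ioi fun r hr => ?_
  have hr : 0 < r := hr
  have h2 : r ^ (1 - β + ρ * k - 1) = r ^ (-β) * (r ^ ρ) ^ k := by
    rw [← Real.rpow_natCast, ← Real.rpow_mul hr.le, ← Real.rpow_add hr]
    ring_nf
  simp only [h2]
  push_cast
  ring

/-- The reflection formula for `1 / Γ`, valid also at the poles, where `Real.Gamma` vanishes. -/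
lemma inv_Gamma_eq_Gamma_one_sub_mul_sin {s : ℝ} (hs : s < 1) :
    (Real.Gamma s)⁻¹ = Real.Gamma (1 - s) * Real.sin (Real.pi * s) / Real.pi := by
  have h := Real.Gamma_mul_Gamma_one_sub s
  have hG : Real.Gamma (1 - s) ≠ 0 := (Real.Gamma_pos_of_pos (by linarith)).ne'
  have hpi := Real.pi_ne_zero
  rcases eq_or_ne (Real.sin (Real.pi * s)) 0 with h0 | h0
  · rw [h0, div_zero, mul_eq_zero, or_iff_left hG] at h
    simp [h, h0]
  · have hG' : Real.Gamma s ≠ 0 := by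
      rintro h1
      rw [h1, zero_mul] at h
      exact (div_ne_zero hpi h0) h.symm
    rw [eq_div_iff h0, mul_assoc] at h
    rw [eq_div_iff hpi, inv_mul_eq_iff_eq_mul₀ hG', h]

/-- For `β < 1` the Wright function is the jump of `cutIntegral` across the branch cut. -/
lemma hasSum_wrightTerm_of_lt_one {ρ β : ℝ} (hρ0 : 0 < ρ) (hρ : ρ < 1 / 2) (hβ : β < 1) (y : ℝ) :
    HasSum (fun k => (wrightTerm ρ β y k : ℂ))
      ((Complex.exp (Real.pi * β * Complex.I) *
          cutIntegral ρ β (y * Complex.exp (-(Real.pi * ρ * Complex.I))) -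
        Complex.exp (-(Real.pi * β * Complex.I)) *
          cutIntegral ρ β (y * Complex.exp (Real.pi * ρ * Complex.I))) /
        (2 * Real.pi * Complex.I)) := by
  have h := ((((hasSum_cutIntegral hρ0 hρ hβ
      (y * Complex.exp (-(Real.pi * ρ * Complex.I)))).mul_left
        (Complex.exp (Real.pi * β * Complex.I))).sub
    ((hasSum_cutIntegral hρ0 hρ hβ (y * Complex.exp (Real.pi * ρ * Complex.I))).mul_left
        (Complex.exp (-(Real.pi * β * Complex.I)))))).div_const (2 * Real.pi * Complex.I)
  refine h.congr_fun fun k => ?_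
  have hk : -ρ * k + β < 1 := by
    have : 0 ≤ ρ * k := by positivity
    linarith
  have e1 : Real.Gamma (1 - (-ρ * k + β)) = Real.Gamma (1 - β + ρ * k) := by ring_nf
  rw [wrightTerm, div_eq_mul_inv, mul_inv, inv_Gamma_eq_Gamma_one_sub_mul_sin hk, e1]
  have e2 : ((Real.sin (Real.pi * (-ρ * k + β)) : ℝ) : ℂ) =
      (Complex.exp (Real.pi * β * Complex.I) * Complex.exp (-(Real.pi * ρ * Complex.I)) ^ k -
        Complex.exp (-(Real.pi * β * Complex.I)) * Complex.exp (Real.pi * ρ * Complex.I) ^ k) /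
        (2 * Complex.I) := by
    rw [← Complex.exp_nat_mul, ← Complex.exp_nat_mul, ← Complex.exp_add, ← Complex.exp_add,
      Complex.ofReal_sin, Complex.sin]
    have hI : Complex.I ≠ 0 := Complex.I_ne_zero
    have a1 : -(((Real.pi * (-ρ * k + β) : ℝ)) : ℂ) * Complex.I =
      -(Real.pi * β * Complex.I) + k * (Real.pi * ρ * Complex.I) := by push_cast; ring
    have a2 : (((Real.pi * (-ρ * k + β) : ℝ)) : ℂ) * Complex.I =
      Real.pi * β * Complex.I + k * (-(Real.pi * ρ * Complex.I)) := by push_cast; ring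
    rw [a1, a2]
    field_simp
    rw [Complex.I_sq]
    ring
  simp only [Complex.ofReal_mul, Complex.ofReal_div, Complex.ofReal_inv, e2]
  have hI : Complex.I ≠ 0 := Complex.I_ne_zero
  have hpi : (Real.pi : ℂ) ≠ 0 := by exact_mod_cast Real.pi_ne_zero
  have hf : (k.factorial : ℂ) ≠ 0 := by exact_mod_cast k.factorial_ne_zero
  have m1 : (-((y : ℂ) * Complex.exp (-(Real.pi * ρ * Complex.I)))) ^ k =
    (-(y : ℂ)) ^ k * Complex.exp (-(Real.pi * ρ * Complex.I)) ^ k := by rw [← mul_pow]; ring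
  have m2 : (-((y : ℂ) * Complex.exp (Real.pi * ρ * Complex.I))) ^ k =
    (-(y : ℂ)) ^ k * Complex.exp (Real.pi * ρ * Complex.I) ^ k := by rw [← mul_pow]; ring
  rw [m1, m2]
  push_cast
  field_simp

lemma wrightTerm_succ (ρ β y : ℝ) (k : ℕ) :
    wrightTerm ρ (β + ρ) y (k + 1) = -y / (k + 1) * wrightTerm ρ β y k := by
  have h : -ρ * ((k + 1 : ℕ) : ℝ) + (β + ρ) = -ρ * k + β := by push_cast; ring
  have hk : (k : ℝ) + 1 ≠ 0 := by positivity
  rw [wrightTerm, wrightTerm, h, Nat.factorial_succ, pow_succ]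
  push_cast
  rw [div_mul_div_comm]
  congr 1 <;> ring

lemma summable_wrightTerm {ρ : ℝ} (hρ0 : 0 < ρ) (hρ : ρ < 1 / 2) (β y : ℝ) :
    Summable (wrightTerm ρ β y) := by
  have hstep : ∀ n : ℕ, ∀ β : ℝ, β < 1 + n * ρ → Summable (wrightTerm ρ β y) := by
    intro n
    induction n with
    | zero =>
      intro β hβ
      have := (hasSum_wrightTerm_of_lt_one hρ0 hρ (by simpa using hβ) y).summable
      exact Complex.summable_ofReal.mp this
    | succ n ih =>
      intro β hβ
      have h1 := (ih (β - ρ) (by push_cast at hβ; linarith)).norm.mul_left |y|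
      rw [← summable_nat_add_iff 1]
      refine Summable.of_norm_bounded h1 fun k => ?_
      have h2 := wrightTerm_succ ρ (β - ρ) y k
      rw [sub_add_cancel] at h2
      rw [h2, norm_mul]
      refine mul_le_mul_of_nonneg_right ?_ (norm_nonneg _)
      rw [norm_div, norm_neg, Real.norm_eq_abs, Real.norm_of_nonneg (by positivity)]
      exact div_le_self (abs_nonneg y) (by linarith [(Nat.cast_nonneg k : (0:ℝ) ≤ k)])
  obtain ⟨n, hn⟩ := exists_nat_gt ((β - 1) / ρ)
  exact hstep n β (by rw [div_lt_iff₀ hρ0] at hn; linarith)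

lemma wrightNeg_eq_tsum (ρ β y : ℝ) : wrightNeg ρ β y = ∑' k, wrightTerm ρ β y k := rfl

lemma wrightNeg_zero (ρ β : ℝ) : wrightNeg ρ β 0 = (Real.Gamma β)⁻¹ := by
  rw [wrightNeg_eq_tsum, tsum_eq_single 0]
  · simp [wrightTerm]
  · intro k hk
    simp [wrightTerm, hk]

lemma hasDerivAt_wrightNeg {ρ : ℝ} (hρ0 : 0 < ρ) (hρ : ρ < 1 / 2) (β y : ℝ) :
    HasDerivAt (wrightNeg ρ β) (-wrightNeg ρ (β - ρ) y) y := by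
  set R := |y| + 1 with hR
  have hR0 : 0 < R := by positivity
  -- the derivative of the term of index `k + 1` is minus the term of index `k` for `β - ρ`
  let g' : ℕ → ℝ → ℝ := fun k z => Nat.casesOn k 0 fun j => -wrightTerm ρ (β - ρ) z j
  have hsum : Summable fun k : ℕ => (Nat.casesOn k 0 fun j => ‖wrightTerm ρ (β - ρ) R j‖ : ℝ) := by
    rw [← summable_nat_add_iff 1]
    exact (summable_wrightTerm hρ0 hρ (β - ρ) R).norm
  have hmem : y ∈ Metric.ball (0 : ℝ) R := by
    rw [Metric.mem_ball, dist_zero_right, Real.norm_eq_abs, hR]; linarith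
  have h := hasDerivAt_tsum_of_isPreconnected (g := fun k z => wrightTerm ρ β z k) (g' := g')
    (y := y) hsum Metric.isOpen_ball (convex_ball (0 : ℝ) R).isPreconnected ?_ ?_ hmem
    (summable_wrightTerm hρ0 hρ β y) hmem
  · have h2 : ∑' k, g' k y = -wrightNeg ρ (β - ρ) y := by
      rw [wrightNeg_eq_tsum, ← tsum_neg]
      have hs : Summable fun k => g' k y := by
        rw [← summable_nat_add_iff 1]
        exact (summable_wrightTerm hρ0 hρ (β - ρ) y).neg
      rw [hs.tsum_eq_zero_add]
      simp [g']
    rw [h2] at h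
    exact h
  · intro k z _
    cases k with
    | zero =>
      simpa [g', wrightTerm] using hasDerivAt_const z _
    | succ k =>
      have e : (fun z => wrightTerm ρ β z (k + 1)) = fun z =>
          (-z) ^ (k + 1) / (((k + 1).factorial : ℝ) * Real.Gamma (-ρ * k + (β - ρ))) := by
        ext z
        rw [wrightTerm]
        congr 3
        push_cast; ring
      rw [e]
      have hd : HasDerivAt (fun z : ℝ => (-z) ^ (k + 1)) ((k + 1 : ℕ) * (-z) ^ k * (-1)) z := by
        simpa using (hasDerivAt_neg z).fun_pow (k + 1)
      refine (hd.div_const _).congr_deriv ?_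
      simp only [g', wrightTerm, Nat.factorial_succ]
      have hk : (k : ℝ) + 1 ≠ 0 := by positivity
      push_cast
      rw [← neg_div, mul_assoc, mul_assoc, mul_div_mul_left _ _ hk]
      ring
  · intro k z hz
    have hz' : |z| ≤ |R| := by
      rw [Metric.mem_ball, dist_zero_right, Real.norm_eq_abs] at hz
      rw [abs_of_pos hR0]; exact hz.le
    cases k with
    | zero => simp [g']
    | succ k =>
      simp only [g', norm_neg, wrightTerm, norm_div, norm_pow, Real.norm_eq_abs]
      gcongr

lemma continuous_wrightNeg {ρ : ℝ} (hρ0 : 0 < ρ) (hρ : ρ < 1 / 2) (β : ℝ) :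
    Continuous (wrightNeg ρ β) :=
  continuous_iff_continuousAt.mpr fun y => (hasDerivAt_wrightNeg hρ0 hρ β y).continuousAt

/-- The contiguous relation coming from `1 / Γ(s - 1) = (s - 1) / Γ(s)`. -/
lemma wrightNeg_sub_one {ρ : ℝ} (hρ0 : 0 < ρ) (hρ : ρ < 1 / 2) (β y : ℝ) :
    wrightNeg ρ (β - 1) y = (β - 1) * wrightNeg ρ β y + ρ * y * wrightNeg ρ (β - ρ) y := by
  have hG : ∀ s : ℝ, (Real.Gamma (s - 1))⁻¹ = (s - 1) * (Real.Gamma s)⁻¹ := by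
    intro s
    rcases eq_or_ne s 1 with rfl | hs
    · simp [Real.Gamma_zero]
    · have hs' : s - 1 ≠ 0 := sub_ne_zero.mpr hs
      have := Real.Gamma_add_one hs'
      rw [sub_add_cancel] at this
      rw [this, mul_inv, ← mul_assoc, mul_inv_cancel₀ hs', one_mul]
  have h1 : ∀ k, wrightTerm ρ (β - 1) y k =
      (β - 1) * wrightTerm ρ β y k + -ρ * (k * wrightTerm ρ β y k) := by
    intro k
    have := hG (-ρ * k + β)
    rw [wrightTerm, wrightTerm, div_eq_mul_inv, mul_inv, ← add_sub_assoc, this]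
    rw [div_eq_mul_inv, mul_inv]
    ring
  have h2 : HasSum (fun k : ℕ => (k : ℝ) * wrightTerm ρ β y k) (-y * wrightNeg ρ (β - ρ) y) := by
    rw [← hasSum_nat_add_iff' 1]
    simp only [Finset.range_one, Finset.sum_singleton, Nat.cast_zero, zero_mul, sub_zero]
    refine ((summable_wrightTerm hρ0 hρ (β - ρ) y).hasSum.mul_left (-y)).congr_fun fun k => ?_
    have := wrightTerm_succ ρ (β - ρ) y k
    have hk : (k : ℝ) + 1 ≠ 0 := by positivity
    rw [sub_add_cancel] at this
    rw [this]
    push_cast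
    field_simp
  have h3 := ((summable_wrightTerm hρ0 hρ β y).hasSum.mul_left (β - 1)).add (h2.mul_left (-ρ))
  rw [wrightNeg_eq_tsum, tsum_congr h1, h3.tsum_eq, wrightNeg_eq_tsum ρ β]
  ring

/-! ### Mellin transform of the Wright functions -/

lemma integrableOn_cpow_mul_cexp_neg_mul {a w : ℂ} (ha : 0 < a.re) (hw : 0 < w.re) :
    IntegrableOn (fun t : ℝ => (t : ℂ) ^ (a - 1) * Complex.exp (-(w * t))) (Ioi 0) := by
  have h := integrableOn_rpow_mul_exp_neg_mul_rpow (p := 1) (s := a.re - 1) (b := w.re)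
    (by linarith) one_pos hw
  refine Integrable.mono' h (Measurable.aestronglyMeasurable (by fun_prop)) ?_
  filter_upwards [ae_restrict_mem measurableSet_Ioi] with t ht
  rw [norm_mul, Complex.norm_cpow_eq_rpow_re_of_pos ht, Complex.norm_exp]
  simp

/-- Euler's integral `∫₀^∞ t^(a-1) exp(-w t) dt = w^(-a) Γ(a)` on the right half-plane `Re w > 0`,
by analytic continuation from the positive axis. -/
lemma integral_cpow_mul_cexp_neg_mul {a w : ℂ} (ha : 0 < a.re) (hw : 0 < w.re) :
    ∫ t in Ioi (0 : ℝ), (t : ℂ) ^ (a - 1) * Complex.exp (-(w * t)) = w ^ (-a) * Complex.Gamma a := by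
  set U : Set ℂ := {w | 0 < w.re} with hU
  have hUo : IsOpen U := isOpen_lt continuous_const Complex.continuous_re
  have hUc : IsPreconnected U := (convex_halfSpace_re_gt 0).isPreconnected
  have hd1 : DifferentiableOn ℂ
      (fun w : ℂ => ∫ t in Ioi (0 : ℝ), (t : ℂ) ^ (a - 1) * Complex.exp (-(w * t))) U := by
    intro w hw
    have hw : 0 < w.re := hw
    refine DifferentiableAt.differentiableWithinAt (HasDerivAt.differentiableAt
      (hasDerivAt_integral_of_dominated_loc_of_deriv_le (s := Metric.ball w (w.re / 2))
      (bound := fun t => t ^ a.re * Real.exp (-(w.re / 2) * t ^ (1 : ℝ)))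
      (F' := fun w t => (t : ℂ) ^ (a - 1) * (Complex.exp (-(w * t)) * (-t)))
      (Metric.ball_mem_nhds w (by linarith)) ?_ ?_ ?_ ?_ ?_ ?_).2)
    · exact Eventually.of_forall fun w => Measurable.aestronglyMeasurable (by fun_prop)
    · exact integrableOn_cpow_mul_cexp_neg_mul ha hw
    · exact Measurable.aestronglyMeasurable (by fun_prop)
    · filter_upwards [ae_restrict_mem measurableSet_Ioi] with t ht x hx
      have ht : 0 < t := ht
      have hx' : w.re / 2 < x.re := by
        rw [Metric.mem_ball, dist_comm, dist_eq_norm] at hx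
        have := (Complex.abs_re_le_norm (w - x)).trans_lt hx
        rw [Complex.sub_re] at this
        linarith [(abs_lt.mp this).2]
      rw [norm_mul, norm_mul, Complex.norm_cpow_eq_rpow_re_of_pos ht, Complex.norm_exp, norm_neg,
        Complex.norm_real, Real.norm_of_nonneg ht.le, Real.rpow_one]
      have e : t ^ a.re = t ^ (a - 1).re * t := by
        rw [Complex.sub_re, Complex.one_re, ← Real.rpow_add_one ht.ne']; ring_nf
      have e2 : Real.exp (-(x * t)).re ≤ Real.exp (-(w.re / 2) * t) := by
        rw [Real.exp_le_exp]
        simp only [Complex.neg_re, Complex.mul_re, Complex.ofReal_re, Complex.ofReal_im, mul_zero,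
          sub_zero]
        nlinarith
      rw [e]
      calc _ = t ^ (a - 1).re * t * Real.exp (-(x * t)).re := by ring
        _ ≤ _ := by gcongr
    · exact integrableOn_rpow_mul_exp_neg_mul_rpow (by linarith) one_pos (by linarith)
    · refine Eventually.of_forall fun t x _ => HasDerivAt.const_mul _ ?_
      have : HasDerivAt (fun w : ℂ => -(w * t)) (-(1 * (t : ℂ))) x :=
        ((hasDerivAt_id x).mul_const (t : ℂ)).neg
      simpa using this.cexp
  have hd2 : DifferentiableOn ℂ (fun w : ℂ => w ^ (-a) * Complex.Gamma a) U := by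
    intro w hw
    refine DifferentiableAt.differentiableWithinAt (DifferentiableAt.mul_const ?_ _)
    exact differentiableAt_id.cpow_const (Or.inl hw)
  have hfreq : ∃ᶠ w in 𝓝[≠] (1 : ℂ),
      (∫ t in Ioi (0 : ℝ), (t : ℂ) ^ (a - 1) * Complex.exp (-(w * t))) =
        w ^ (-a) * Complex.Gamma a := by
    have h1 : Tendsto (fun x : ℝ => (x : ℂ)) (𝓝[>] 1) (𝓝[≠] (1 : ℂ)) := by
      refine tendsto_nhdsWithin_iff.mpr ⟨?_, ?_⟩
      · have := (Complex.continuous_ofReal.tendsto (1 : ℝ)).mono_left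
          (nhdsWithin_le_nhds (s := Ioi 1))
        simpa using this
      · filter_upwards [self_mem_nhdsWithin] with x hx
        have hx : (1 : ℝ) < x := hx
        simp only [mem_compl_iff, mem_singleton_iff]
        exact_mod_cast hx.ne'
    refine h1.frequently (Eventually.frequently ?_)
    filter_upwards [self_mem_nhdsWithin] with x hx
    have hx0 : (0 : ℝ) < x := lt_trans one_pos hx
    rw [Complex.integral_cpow_mul_exp_neg_mul_Ioi ha hx0, one_div,
      Complex.inv_cpow _ _ (by rw [Complex.arg_ofReal_of_nonneg hx0.le]; exact Real.pi_pos.ne),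
      Complex.cpow_neg]
  exact (hd1.analyticOnNhd hUo).eqOn_of_preconnected_of_frequently_eq (hd2.analyticOnNhd hUo) hUc
    (z₀ := 1) (by simp [hU]) hfreq hw

lemma integrable_cutIntegrand {ρ β : ℝ} {u z : ℂ}
    (hu : 0 < u.re) (hz : 0 < z.re) (hz1 : β + ρ * z.re < 1) :
    Integrable (fun p : ℝ × ℝ => (p.1 : ℂ) ^ (z - 1) * (((Real.exp (-p.2) * p.2 ^ (-β) : ℝ) : ℂ) *
      Complex.exp (-(p.1 * u * (p.2 ^ ρ : ℝ)))))
      ((volume.restrict (Ioi (0 : ℝ))).prod (volume.restrict (Ioi (0 : ℝ)))) := by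
  have hnorm : ∀ r : ℝ, 0 < r → ∀ y : ℝ, 0 < y →
      ‖(y : ℂ) ^ (z - 1) * (((Real.exp (-r) * r ^ (-β) : ℝ) : ℂ) *
        Complex.exp (-(y * u * (r ^ ρ : ℝ))))‖ =
      Real.exp (-r) * r ^ (-β) * (y ^ (z.re - 1) * Real.exp (-(u.re * r ^ ρ * y))) := by
    intro r hr y hy
    rw [norm_mul, norm_mul, Complex.norm_cpow_eq_rpow_re_of_pos hy, Complex.norm_exp,
      Complex.norm_real, Real.norm_of_nonneg (by positivity)]
    simp only [Complex.sub_re, Complex.one_re, Complex.neg_re, Complex.mul_re, Complex.ofReal_re,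
      Complex.ofReal_im, Complex.mul_im, mul_zero, zero_mul, sub_zero]
    ring_nf
  rw [integrable_prod_iff' (Measurable.aestronglyMeasurable (by fun_prop))]
  constructor
  · filter_upwards [ae_restrict_mem measurableSet_Ioi] with r hr
    have hr : 0 < r := hr
    have h1 : 0 < (u * (r ^ ρ : ℝ)).re := by
      rw [Complex.re_mul_ofReal]; positivity
    have := (integrableOn_cpow_mul_cexp_neg_mul hz h1).const_mul
      ((Real.exp (-r) * r ^ (-β) : ℝ) : ℂ)
    refine this.congr (Eventually.of_forall fun y => ?_)
    simp only
    rw [show u * ((r ^ ρ : ℝ) : ℂ) * y = y * u * ((r ^ ρ : ℝ) : ℂ) by ring]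
    ring
  · have h2 : IntegrableOn (fun r : ℝ => u.re ^ (-z.re) * Real.Gamma z.re *
        (r ^ (-β - ρ * z.re) * Real.exp (-1 * r ^ (1 : ℝ)))) (Ioi 0) :=
      (integrableOn_rpow_mul_exp_neg_mul_rpow (by linarith) one_pos one_pos).const_mul _
    refine h2.congr ?_
    filter_upwards [ae_restrict_mem measurableSet_Ioi] with r hr
    have hr : 0 < r := hr
    rw [setIntegral_congr_fun measurableSet_Ioi fun y hy => hnorm r hr y hy,
      integral_const_mul, Real.integral_rpow_mul_exp_neg_mul_Ioi hz (by positivity), one_div,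
      Real.inv_rpow (by positivity), ← Real.rpow_neg (by positivity),
      Real.mul_rpow hu.le (by positivity), ← Real.rpow_mul hr.le, sub_eq_add_neg,
      Real.rpow_add hr, Real.rpow_one]
    ring_nf

lemma hasMellin_cutIntegral {ρ β : ℝ} {u z : ℂ}
    (hu : 0 < u.re) (hz : 0 < z.re) (hz1 : β + ρ * z.re < 1) :
    HasMellin (fun y : ℝ => cutIntegral ρ β (y * u)) z
      (Complex.Gamma z * u ^ (-z) * Complex.Gamma (1 - β - ρ * z)) := by
  have hint := integrable_cutIntegrand hu hz hz1
  have heq : ∀ y : ℝ, (y : ℂ) ^ (z - 1) • cutIntegral ρ β (y * u) = ∫ r in Ioi (0 : ℝ),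
      (y : ℂ) ^ (z - 1) * (((Real.exp (-r) * r ^ (-β) : ℝ) : ℂ) *
        Complex.exp (-(y * u * (r ^ ρ : ℝ)))) := fun y => by
    rw [integral_const_mul, cutIntegral, smul_eq_mul]
  refine ⟨?_, ?_⟩
  · refine hint.integral_prod_left.congr (Eventually.of_forall fun y => ?_)
    exact (heq y).symm
  · rw [mellin]
    simp_rw [heq]
    rw [integral_integral_swap hint]
    have hu0 : u ≠ 0 := by rintro rfl; simp at hu
    have hin : ∀ r ∈ Ioi (0 : ℝ), (∫ y in Ioi (0 : ℝ), (y : ℂ) ^ (z - 1) *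
        (((Real.exp (-r) * r ^ (-β) : ℝ) : ℂ) * Complex.exp (-(y * u * (r ^ ρ : ℝ))))) =
        Complex.Gamma z * u ^ (-z) *
          ((Real.exp (-r) : ℝ) * (r : ℂ) ^ ((1 - β - ρ * z) - 1)) := by
      intro r hr
      have hr : 0 < r := hr
      have hrc : (r : ℂ) ≠ 0 := by exact_mod_cast hr.ne'
      have h1 : 0 < (u * (r ^ ρ : ℝ)).re := by
        rw [Complex.re_mul_ofReal]; positivity
      have e1 : ∀ y : ℝ, (y : ℂ) ^ (z - 1) *
          (((Real.exp (-r) * r ^ (-β) : ℝ) : ℂ) * Complex.exp (-(y * u * (r ^ ρ : ℝ)))) =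
          ((Real.exp (-r) * r ^ (-β) : ℝ) : ℂ) * ((y : ℂ) ^ (z - 1) *
            Complex.exp (-(u * (r ^ ρ : ℝ) * y))) := by
        intro y
        rw [show u * ((r ^ ρ : ℝ) : ℂ) * y = y * u * ((r ^ ρ : ℝ) : ℂ) by ring]
        ring
      simp_rw [e1]
      rw [integral_const_mul, integral_cpow_mul_cexp_neg_mul hz h1]
      have hpos : 0 < r ^ ρ := by positivity
      have e2 : (u * ((r ^ ρ : ℝ) : ℂ)) ^ (-z) = u ^ (-z) * (r : ℂ) ^ (-(ρ * z)) := by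
        rw [Complex.cpow_def_of_ne_zero (mul_ne_zero hu0 (by exact_mod_cast hpos.ne')),
          Complex.cpow_def_of_ne_zero hu0, Complex.cpow_def_of_ne_zero hrc, mul_comm u,
          Complex.log_ofReal_mul hpos hu0, ← Complex.exp_add, Real.log_rpow hr,
          ← Complex.ofReal_log hr.le]
        push_cast
        ring_nf
      have e3 : (r : ℂ) ^ ((1 - β - ρ * z) - 1) = ((r ^ (-β) : ℝ) : ℂ) * (r : ℂ) ^ (-(ρ * z)) := by
        rw [Complex.ofReal_cpow hr.le, ← Complex.cpow_add _ _ hrc]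
        push_cast
        ring_nf
      rw [e2, e3]
      push_cast
      ring
    rw [setIntegral_congr_fun measurableSet_Ioi hin, integral_const_mul,
      Complex.Gamma_eq_integral (s := 1 - β - ρ * z) (by simp; linarith), Complex.GammaIntegral]

/-- The Mellin transform of `y ↦ W(-y; -ρ; β)` is `Γ(z) / Γ(β + ρ z)`. -/
lemma hasMellin_wrightNeg {ρ β : ℝ} (hρ0 : 0 < ρ) (hρ : ρ < 1 / 2) {z : ℂ}
    (hz : 0 < z.re) (hz1 : β + ρ * z.re < 1) :
    HasMellin (fun y => (wrightNeg ρ β y : ℂ)) z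
      (Complex.Gamma z / Complex.Gamma (β + ρ * z)) := by
  have hβ : β < 1 := by nlinarith
  have hpiρ : |Real.pi * ρ| < Real.pi / 2 := by
    rw [abs_of_pos (by positivity)]; nlinarith [Real.pi_pos]
  have hcos : 0 < Real.cos (Real.pi * ρ) := Real.cos_pos_of_mem_Ioo (abs_lt.mp hpiρ)
  have a1 : Real.pi * ρ * Complex.I = ((Real.pi * ρ : ℝ) : ℂ) * Complex.I := by push_cast; ring
  have a2 : -(Real.pi * ρ * Complex.I) = ((-(Real.pi * ρ) : ℝ) : ℂ) * Complex.I := by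
    push_cast; ring
  have h1 := hasMellin_cutIntegral (ρ := ρ) (β := β) (u := Complex.exp (-(Real.pi * ρ * Complex.I)))
    (by rw [a2, Complex.exp_ofReal_mul_I_re, Real.cos_neg]; exact hcos) hz hz1
  have h2 := hasMellin_cutIntegral (ρ := ρ) (β := β) (u := Complex.exp (Real.pi * ρ * Complex.I))
    (by rw [a1, Complex.exp_ofReal_mul_I_re]; exact hcos) hz hz1
  have h3 := hasMellin_sub
    (hasMellin_const_smul h1.1 (Complex.exp (Real.pi * β * Complex.I))).1
    (hasMellin_const_smul h2.1 (Complex.exp (-(Real.pi * β * Complex.I)))).1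
  have h4 := hasMellin_const_smul h3.1 (2 * Real.pi * Complex.I)⁻¹
  have hW : (fun y => (wrightNeg ρ β y : ℂ)) = fun y : ℝ => (2 * Real.pi * Complex.I)⁻¹ •
      (Complex.exp (Real.pi * β * Complex.I) •
          cutIntegral ρ β (y * Complex.exp (-(Real.pi * ρ * Complex.I))) -
        Complex.exp (-(Real.pi * β * Complex.I)) •
          cutIntegral ρ β (y * Complex.exp (Real.pi * ρ * Complex.I))) := by
    ext y
    rw [wrightNeg_eq_tsum, Complex.ofReal_tsum,
      (hasSum_wrightTerm_of_lt_one hρ0 hρ hβ y).tsum_eq, smul_eq_mul, smul_eq_mul, smul_eq_mul,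
      div_eq_inv_mul]
  rw [hW]
  refine ⟨h4.1, h4.2.trans ?_⟩
  rw [h3.2, (hasMellin_const_smul h1.1 (Complex.exp (Real.pi * β * Complex.I))).2,
    (hasMellin_const_smul h2.1 (Complex.exp (-(Real.pi * β * Complex.I)))).2, h1.2, h2.2]
  have hlog1 : Complex.log (Complex.exp (-(Real.pi * ρ * Complex.I))) =
      -(Real.pi * ρ * Complex.I) := by
    have := abs_lt.mp hpiρ
    rw [a2, Complex.log_exp] <;> simp <;> linarith [Real.pi_pos]
  have hlog2 : Complex.log (Complex.exp (Real.pi * ρ * Complex.I)) = Real.pi * ρ * Complex.I := by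
    have := abs_lt.mp hpiρ
    rw [a1, Complex.log_exp] <;> simp <;> linarith [Real.pi_pos]
  rw [Complex.cpow_def_of_ne_zero (Complex.exp_ne_zero _),
    Complex.cpow_def_of_ne_zero (Complex.exp_ne_zero _), hlog1, hlog2]
  have hI : Complex.I ≠ 0 := Complex.I_ne_zero
  have hpi : (Real.pi : ℂ) ≠ 0 := by exact_mod_cast Real.pi_ne_zero
  have hsin : Complex.sin (Real.pi * (β + ρ * z)) =
      (Complex.exp (Real.pi * β * Complex.I) * Complex.exp (-(Real.pi * ρ * Complex.I) * -z) -
        Complex.exp (-(Real.pi * β * Complex.I)) * Complex.exp (Real.pi * ρ * Complex.I * -z)) /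
        (2 * Complex.I) := by
    rw [Complex.sin, ← Complex.exp_add, ← Complex.exp_add,
      show -(Real.pi * (β + ρ * z)) * Complex.I =
        -(Real.pi * β * Complex.I) + Real.pi * ρ * Complex.I * -z by ring,
      show (Real.pi * (β + ρ * z)) * Complex.I =
        Real.pi * β * Complex.I + -(Real.pi * ρ * Complex.I) * -z by ring]
    field_simp
    rw [Complex.I_sq]
    ring
  have hG1 : Complex.Gamma (1 - (β + ρ * z)) ≠ 0 :=
    Complex.Gamma_ne_zero_of_re_pos (by simp; linarith)
  -- the reflection formula, also when `Γ(β + ρ z)` is at a pole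
  have hrefl : (Complex.Gamma (β + ρ * z))⁻¹ =
      Complex.Gamma (1 - (β + ρ * z)) * Complex.sin (Real.pi * (β + ρ * z)) / Real.pi := by
    have h := Complex.Gamma_mul_Gamma_one_sub (β + ρ * z)
    rcases eq_or_ne (Complex.sin (Real.pi * (β + ρ * z))) 0 with h0 | h0
    · rw [h0, div_zero, mul_eq_zero, or_iff_left hG1] at h
      simp [h, h0]
    · have hG' : Complex.Gamma (β + ρ * z) ≠ 0 := by
        intro h1
        rw [h1, zero_mul] at h
        exact (div_ne_zero hpi h0) h.symm
      rw [eq_div_iff h0, mul_assoc] at h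
      rw [eq_div_iff hpi, inv_mul_eq_iff_eq_mul₀ hG', h]
  rw [div_eq_mul_inv (Complex.Gamma z), hrefl, hsin]
  simp only [smul_eq_mul]
  rw [show (1 : ℂ) - β - ρ * z = 1 - (β + ρ * z) by ring]
  field_simp

/-- The decay `W(-y; -ρ; β) = O(y ^ (-(1 - β) / ρ))`, which makes `wrightKernel ρ β x` bounded in
time for `x > 0`. -/
lemma exists_abs_wrightNeg_le {ρ β : ℝ} (hρ0 : 0 < ρ) (hρ : ρ < 1 / 2) (hβ : β < 1) :
    ∃ C : ℝ, 0 ≤ C ∧ ∀ y : ℝ, 0 < y → |wrightNeg ρ β y| ≤ C * y ^ (-(1 - β) / ρ) := by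
  have hcos : 0 < Real.cos (Real.pi * ρ) := by
    refine Real.cos_pos_of_mem_Ioo (abs_lt.mp ?_)
    rw [abs_of_pos (by positivity)]; nlinarith [Real.pi_pos]
  have a1 : Real.pi * ρ * Complex.I = ((Real.pi * ρ : ℝ) : ℂ) * Complex.I := by push_cast; ring
  have a2 : -(Real.pi * ρ * Complex.I) = ((-(Real.pi * ρ) : ℝ) : ℂ) * Complex.I := by
    push_cast; ring
  have a3 : Real.pi * β * Complex.I = ((Real.pi * β : ℝ) : ℂ) * Complex.I := by push_cast; ring
  have a4 : -(Real.pi * β * Complex.I) = ((-(Real.pi * β) : ℝ) : ℂ) * Complex.I := by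
    push_cast; ring
  set D : ℝ := Real.cos (Real.pi * ρ) ^ (-(1 - β) / ρ) * (1 / ρ) * Real.Gamma ((1 - β) / ρ) with hD
  have hD0 : 0 ≤ D := by
    have : 0 < Real.Gamma ((1 - β) / ρ) := Real.Gamma_pos_of_pos (div_pos (by linarith) hρ0)
    positivity
  have hcut : ∀ u : ℂ, u.re = Real.cos (Real.pi * ρ) → ∀ y : ℝ, 0 < y →
      ‖cutIntegral ρ β (y * u)‖ ≤ D * y ^ (-(1 - β) / ρ) := by
    intro u hu y hy
    have hb : 0 < y * Real.cos (Real.pi * ρ) := by positivity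
    have h1 := integral_rpow_mul_exp_neg_mul_rpow hρ0 (q := -β) (by linarith) hb
    have h2 := integrableOn_rpow_mul_exp_neg_mul_rpow (s := -β) (by linarith) hρ0 hb
    have h3 : D * y ^ (-(1 - β) / ρ) =
        ∫ x in Ioi (0 : ℝ), x ^ (-β) * Real.exp (-(y * Real.cos (Real.pi * ρ)) * x ^ ρ) := by
      rw [h1, hD, show -(-β + 1) = -(1 - β) by ring, show -β + 1 = 1 - β by ring,
        Real.mul_rpow hy.le hcos.le]
      ring
    rw [h3, cutIntegral]
    refine norm_integral_le_of_norm_le h2 ?_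
    filter_upwards [ae_restrict_mem measurableSet_Ioi] with r hr
    have hr : 0 < r := hr
    rw [norm_mul, Complex.norm_real, Real.norm_of_nonneg (by positivity), Complex.norm_exp]
    have e1 : (-((y : ℂ) * u * ((r ^ ρ : ℝ) : ℂ))).re =
        -(y * Real.cos (Real.pi * ρ)) * r ^ ρ := by
      rw [Complex.neg_re, Complex.re_mul_ofReal, Complex.re_ofReal_mul, hu]; ring
    rw [e1]
    have : Real.exp (-r) ≤ 1 := Real.exp_le_one_iff.mpr (by linarith)
    have h0 : 0 ≤ r ^ (-β) := by positivity
    gcongr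
    nlinarith
  refine ⟨D / Real.pi, by positivity, fun y hy => ?_⟩
  have h1 := hcut _ (show (Complex.exp (-(Real.pi * ρ * Complex.I))).re = _ by
    rw [a2, Complex.exp_ofReal_mul_I_re, Real.cos_neg]) y hy
  have h2 := hcut _ (show (Complex.exp (Real.pi * ρ * Complex.I)).re = _ by
    rw [a1, Complex.exp_ofReal_mul_I_re]) y hy
  have h3 : ‖(wrightNeg ρ β y : ℂ)‖ ≤ (D * y ^ (-(1 - β) / ρ) + D * y ^ (-(1 - β) / ρ)) /
      (2 * Real.pi) := by
    rw [wrightNeg_eq_tsum, Complex.ofReal_tsum,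
      (hasSum_wrightTerm_of_lt_one hρ0 hρ hβ y).tsum_eq, norm_div]
    have e : ‖(2 * Real.pi * Complex.I : ℂ)‖ = 2 * Real.pi := by
      simp [abs_of_pos Real.pi_pos]
    rw [e]
    gcongr
    refine (norm_sub_le _ _).trans (add_le_add ?_ ?_)
    · rw [norm_mul, a3, Complex.norm_exp_ofReal_mul_I, one_mul]; exact h1
    · rw [norm_mul, a4, Complex.norm_exp_ofReal_mul_I, one_mul]; exact h2
  rw [Complex.norm_real, Real.norm_eq_abs] at h3
  refine h3.trans (le_of_eq ?_)
  have := Real.pi_ne_zero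
  field_simp
  ring

/-! ### Fractional integrals of the self-similar kernels -/

/-- The self-similar kernel `t ^ (β - 1) W(-x t ^ (-ρ); -ρ; β)`, whose Laplace transform in `t` is
`s ^ (-β) exp(-x s ^ ρ)`. -/
noncomputable def wrightKernel (ρ β x t : ℝ) : ℝ := t ^ (β - 1) * wrightNeg ρ β (x / t ^ ρ)

/-- The fractional integral of order `γ` of `wrightKernel ρ β x` at time `1`, without the factor
`1 / Γ(γ)`. -/
noncomputable def fracKernel (ρ γ β x : ℝ) : ℝ :=
  ∫ τ in Ioo (0 : ℝ) 1, (1 - τ) ^ (γ - 1) * wrightKernel ρ β x τ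

lemma exists_abs_wrightKernel_le {ρ β : ℝ} (hρ0 : 0 < ρ) (hρ : ρ < 1 / 2) (hβ : β < 1) :
    ∃ C : ℝ, 0 ≤ C ∧ ∀ x t : ℝ, 0 < x → 0 < t →
      |wrightKernel ρ β x t| ≤ C * x ^ (-(1 - β) / ρ) := by
  obtain ⟨C, hC, h⟩ := exists_abs_wrightNeg_le hρ0 hρ hβ
  refine ⟨C, hC, fun x t hx ht => ?_⟩
  rw [wrightKernel, abs_mul, abs_of_pos (by positivity : 0 < t ^ (β - 1))]
  calc _ ≤ t ^ (β - 1) * (C * (x / t ^ ρ) ^ (-(1 - β) / ρ)) := by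
        gcongr; exact h _ (by positivity)
    _ = _ := by
      rw [Real.div_rpow hx.le (by positivity), ← Real.rpow_mul ht.le,
        show ρ * (-(1 - β) / ρ) = β - 1 by field_simp; ring]
      have : t ^ (β - 1) ≠ 0 := by positivity
      field_simp

lemma continuousOn_wrightKernel {ρ : ℝ} (hρ0 : 0 < ρ) (hρ : ρ < 1 / 2) (β x : ℝ) :
    ContinuousOn (wrightKernel ρ β x) (Ioi 0) := by
  intro t ht
  have ht : 0 < t := ht
  refine ContinuousAt.continuousWithinAt (ContinuousAt.mul ?_ ?_)
  · exact Real.continuousAt_rpow_const _ _ (Or.inl ht.ne')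
  · refine (continuous_wrightNeg hρ0 hρ β).continuousAt.comp ?_
    exact continuousAt_const.div (Real.continuousAt_rpow_const _ _ (Or.inl ht.ne'))
      (by positivity)

lemma measurable_wrightKernel {ρ : ℝ} (hρ0 : 0 < ρ) (hρ : ρ < 1 / 2) (β : ℝ) :
    Measurable fun p : ℝ × ℝ => wrightKernel ρ β p.1 p.2 := by
  have := (continuous_wrightNeg hρ0 hρ β).measurable
  unfold wrightKernel
  fun_prop

lemma integrableOn_one_sub_rpow {γ : ℝ} (hγ : 0 < γ) :
    IntegrableOn (fun τ : ℝ => (1 - τ) ^ (γ - 1)) (Ioo 0 1) := by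
  rw [← integrableOn_Ioc_iff_integrableOn_Ioo, ← intervalIntegrable_iff_integrableOn_Ioc_of_le
    zero_le_one]
  have := (intervalIntegral.intervalIntegrable_rpow' (a := 0) (b := 1) (r := γ - 1)
    (by linarith)).comp_sub_left 1
  simpa using this.symm

lemma continuousAt_fracKernel {ρ γ β : ℝ} (hρ0 : 0 < ρ) (hρ : ρ < 1 / 2) (hγ : 0 < γ) (hβ : β < 1)
    {x : ℝ} (hx : 0 < x) : ContinuousAt (fracKernel ρ γ β) x := by
  obtain ⟨C, hC, h⟩ := exists_abs_wrightKernel_le hρ0 hρ hβ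
  refine continuousAt_of_dominated
    (bound := fun τ => (1 - τ) ^ (γ - 1) * (C * (x / 2) ^ (-(1 - β) / ρ))) ?_ ?_ ?_ ?_
  · refine Eventually.of_forall fun y => Measurable.aestronglyMeasurable ?_
    have := (measurable_wrightKernel hρ0 hρ β).comp (measurable_prodMk_left (x := y))
    exact Measurable.mul (by fun_prop) this
  · filter_upwards [lt_mem_nhds (half_lt_self hx)] with y hy
    filter_upwards [ae_restrict_mem measurableSet_Ioo] with τ hτ
    have h1 : 0 < 1 - τ := by linarith [hτ.2]
    rw [norm_mul, Real.norm_of_nonneg (by positivity), Real.norm_eq_abs]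
    gcongr
    refine (h y τ (by linarith) hτ.1).trans ?_
    gcongr C * ?_
    exact Real.rpow_le_rpow_of_nonpos (by linarith) hy.le
      (div_nonpos_of_nonpos_of_nonneg (by linarith) hρ0.le)
  · exact (integrableOn_one_sub_rpow hγ).mul_const _
  · filter_upwards with τ
    refine continuousAt_const.mul (continuousAt_const.mul ?_)
    exact (continuous_wrightNeg hρ0 hρ β).continuousAt.comp (continuousAt_id.div_const _)

/-- Two continuous functions on `(0, ∞)` with the same Mellin transform on a vertical line are
equal. -/
lemma eq_of_hasMellin {f g : ℝ → ℝ} {σ : ℝ}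
    (hf : ∀ x, 0 < x → ContinuousAt f x) (hg : ∀ x, 0 < x → ContinuousAt g x) {m : ℂ → ℂ}
    (hfm : ∀ z : ℂ, z.re = σ → HasMellin (fun x => (f x : ℂ)) z (m z))
    (hgm : ∀ z : ℂ, z.re = σ → HasMellin (fun x => (g x : ℂ)) z (m z)) {x : ℝ} (hx : 0 < x) :
    f x = g x := by
  have hsub : ∀ z : ℂ, z.re = σ → HasMellin (fun x => (f x : ℂ) - (g x : ℂ)) z 0 := fun z hz => by
    have := hasMellin_sub (hfm z hz).1 (hgm z hz).1
    rw [(hfm z hz).2, (hgm z hz).2, sub_self] at this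
    exact this
  have hzero : ∀ y : ℝ, mellin (fun x => (f x : ℂ) - (g x : ℂ)) (σ + y * Complex.I) = 0 :=
    fun y => (hsub _ (by simp)).2
  have hinv := mellinInv_mellin_eq σ (fun x => (f x : ℂ) - (g x : ℂ)) hx
    (hsub σ (by simp)).1 ?_ ?_
  · rw [mellinInv] at hinv
    simp only [hzero, smul_zero, integral_zero] at hinv
    have := sub_eq_zero.mp hinv.symm
    exact_mod_cast this
  · simp only [Complex.VerticalIntegrable, hzero]
    exact integrable_zero _ _ _
  · exact (Complex.continuous_ofReal.continuousAt.comp (hf x hx)).sub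
      (Complex.continuous_ofReal.continuousAt.comp (hg x hx))

/-- The Mellin transform in `x` of the fractional integral of `wrightKernel ρ β x`. It depends on
`β` and `γ` only through the factor `Γ(γ)` and the sum `β + γ`. -/
lemma hasMellin_fracKernel {ρ γ β : ℝ} (hρ0 : 0 < ρ) (hρ : ρ < 1 / 2) (hγ : 0 < γ) {z : ℂ}
    (hz : 0 < z.re) (hz0 : 0 < β + ρ * z.re) (hz1 : β + ρ * z.re < 1) :
    HasMellin (fun x => (fracKernel ρ γ β x : ℂ)) z
      (Real.Gamma γ * (Complex.Gamma z / Complex.Gamma (β + γ + ρ * z))) := by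
  have hW := hasMellin_wrightNeg (β := β) hρ0 hρ hz hz1
  set s : ℂ := β + ρ * z with hs
  have hsre : s.re = β + ρ * z.re := by simp [hs]
  have hbeta := Complex.betaIntegral_convergent (u := s) (v := γ) (by rw [hsre]; exact hz0)
    (by simpa using hγ)
  rw [intervalIntegrable_iff_integrableOn_Ioc_of_le zero_le_one,
    integrableOn_Ioc_iff_integrableOn_Ioo] at hbeta
  set F : ℝ × ℝ → ℂ := fun p => (p.1 : ℂ) ^ (z - 1) *
    (((1 - p.2) ^ (γ - 1) * wrightKernel ρ β p.1 p.2 : ℝ) : ℂ) with hF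
  have hFeq : ∀ τ ∈ Ioo (0 : ℝ) 1, ∀ x : ℝ, F (x, τ) =
      (((1 - τ) ^ (γ - 1) * τ ^ (β - 1) : ℝ) : ℂ) *
        ((x : ℂ) ^ (z - 1) • (wrightNeg ρ β (x / τ ^ ρ) : ℂ)) := by
    intro τ _ x
    simp only [hF, wrightKernel, smul_eq_mul]
    push_cast
    ring
  have hint : Integrable F ((volume.restrict (Ioi (0 : ℝ))).prod
      (volume.restrict (Ioo (0 : ℝ) 1))) := by
    have hmeas : Measurable F := by
      have := measurable_wrightKernel hρ0 hρ β
      rw [hF]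
      fun_prop
    rw [integrable_prod_iff' hmeas.aestronglyMeasurable]
    constructor
    · filter_upwards [ae_restrict_mem measurableSet_Ioo] with τ hτ
      have h1 : MellinConvergent (fun x : ℝ => (wrightNeg ρ β (x / τ ^ ρ) : ℂ)) z := by
        have ha : 0 < (τ ^ ρ)⁻¹ := by have := hτ.1; positivity
        simp only [div_eq_inv_mul]
        exact (MellinConvergent.comp_mul_left ha).mpr hW.1
      refine (h1.const_mul (((1 - τ) ^ (γ - 1) * τ ^ (β - 1) : ℝ) : ℂ)).congr ?_
      exact Eventually.of_forall fun x => (hFeq τ hτ x).symm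
    · set g : ℝ → ℝ := fun y => ‖(y : ℂ) ^ (z - 1) • (wrightNeg ρ β y : ℂ)‖ with hg
      set K : ℝ := ∫ y in Ioi (0 : ℝ), g y with hK
      refine (hbeta.norm.mul_const K).congr ?_
      filter_upwards [ae_restrict_mem measurableSet_Ioo] with τ hτ
      have hτ0 : 0 < τ := hτ.1
      have hτ1 : 0 < 1 - τ := by linarith [hτ.2]
      have ha : 0 < (τ ^ ρ)⁻¹ := by positivity
      have e1 : ∀ x ∈ Ioi (0 : ℝ), ‖F (x, τ)‖ = ((1 - τ) ^ (γ - 1) * τ ^ (β - 1)) *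
          (((τ ^ ρ)⁻¹) ^ (-(z.re - 1)) *
            g ((τ ^ ρ)⁻¹ * x)) := by
        intro x hx
        have hx : 0 < x := hx
        have hax : 0 < (τ ^ ρ)⁻¹ * x := by positivity
        rw [hFeq τ hτ x, norm_mul, Complex.norm_real, Real.norm_of_nonneg (by positivity)]
        congr 1
        simp only [hg, norm_smul]
        rw [Complex.norm_cpow_eq_rpow_re_of_pos hx, Complex.norm_cpow_eq_rpow_re_of_pos hax,
          Complex.sub_re, Complex.one_re, Real.mul_rpow ha.le hx.le, ← mul_assoc, ← mul_assoc,
          ← Real.rpow_add ha, neg_add_cancel, Real.rpow_zero, one_mul, ← div_eq_inv_mul]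
      rw [setIntegral_congr_fun measurableSet_Ioi e1, integral_const_mul, integral_const_mul,
        integral_comp_mul_left_Ioi _ _ ha, mul_zero, ← hK, smul_eq_mul, inv_inv, norm_mul,
        Complex.norm_cpow_eq_rpow_re_of_pos hτ0, Complex.sub_re, Complex.one_re, hsre]
      have e2 : ‖(1 - (τ : ℂ)) ^ ((γ : ℂ) - 1)‖ = (1 - τ) ^ (γ - 1) := by
        rw [show (1 - (τ : ℂ)) = ((1 - τ : ℝ) : ℂ) by push_cast; ring,
          Complex.norm_cpow_eq_rpow_re_of_pos hτ1]
        simp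
      have e3 : τ ^ (β + ρ * z.re - 1) = τ ^ (β - 1) * ((τ ^ ρ)⁻¹ ^ (-(z.re - 1)) * τ ^ ρ) := by
        rw [Real.inv_rpow (by positivity), Real.rpow_neg (by positivity), inv_inv,
          ← Real.rpow_mul hτ0.le, ← Real.rpow_add hτ0, ← Real.rpow_add hτ0]
        ring_nf
      rw [e2, e3]
      ring
  have hFint : ∀ x : ℝ, (x : ℂ) ^ (z - 1) • (fracKernel ρ γ β x : ℂ) =
      ∫ τ in Ioo (0 : ℝ) 1, F (x, τ) := fun x => by
    simp only [hF]
    rw [integral_const_mul, fracKernel, integral_complex_ofReal, smul_eq_mul]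
  refine ⟨hint.integral_prod_left.congr (Eventually.of_forall fun x => (hFint x).symm), ?_⟩
  rw [mellin]
  simp_rw [hFint]
  rw [integral_integral_swap (f := fun x τ => F (x, τ)) hint]
  have hin : ∀ τ ∈ Ioo (0 : ℝ) 1, (∫ x in Ioi (0 : ℝ), F (x, τ)) =
      ((τ : ℂ) ^ (s - 1) * (1 - (τ : ℂ)) ^ ((γ : ℂ) - 1)) *
        (Complex.Gamma z / Complex.Gamma s) := by
    intro τ hτ
    have hτ0 : 0 < τ := hτ.1
    have hτc : (τ : ℂ) ≠ 0 := by exact_mod_cast hτ0.ne'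
    have hτ1 : 0 < 1 - τ := by linarith [hτ.2]
    have ha : 0 < (τ ^ ρ)⁻¹ := by positivity
    rw [setIntegral_congr_fun measurableSet_Ioi fun x _ => hFeq τ hτ x, integral_const_mul]
    have e1 : (∫ x in Ioi (0 : ℝ), (x : ℂ) ^ (z - 1) • (wrightNeg ρ β (x / τ ^ ρ) : ℂ)) =
        (((τ ^ ρ)⁻¹ : ℝ) : ℂ) ^ (-z) • (Complex.Gamma z / Complex.Gamma s) := by
      rw [← hW.2, ← mellin_comp_mul_left _ _ ha, mellin]
      simp only [div_eq_inv_mul]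
    have e2 : (((τ ^ ρ)⁻¹ : ℝ) : ℂ) ^ (-z) = (τ : ℂ) ^ (ρ * z) := by
      rw [Complex.cpow_def_of_ne_zero (by exact_mod_cast ha.ne'),
        Complex.cpow_def_of_ne_zero hτc, ← Complex.ofReal_log ha.le, ← Complex.ofReal_log hτ0.le,
        Real.log_inv, Real.log_rpow hτ0]
      push_cast
      ring_nf
    have e3 : (τ : ℂ) ^ (s - 1) = ((τ ^ (β - 1) : ℝ) : ℂ) * (τ : ℂ) ^ (ρ * z) := by
      rw [Complex.ofReal_cpow hτ0.le, ← Complex.cpow_add _ _ hτc, hs]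
      push_cast
      ring_nf
    have e4 : (1 - (τ : ℂ)) ^ ((γ : ℂ) - 1) = (((1 - τ) ^ (γ - 1) : ℝ) : ℂ) := by
      rw [Complex.ofReal_cpow hτ1.le]
      push_cast
      rfl
    rw [e1, e2, e3, e4, smul_eq_mul]
    push_cast
    ring
  rw [setIntegral_congr_fun measurableSet_Ioo hin, integral_mul_const,
    ← integral_Ioc_eq_integral_Ioo, ← intervalIntegral.integral_of_le zero_le_one]
  have hB := Complex.Gamma_mul_Gamma_eq_betaIntegral (s := s) (t := γ) (by rw [hsre]; exact hz0)
    (by simpa using hγ)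
  rw [Complex.betaIntegral] at hB
  have hG1 : Complex.Gamma s ≠ 0 := Complex.Gamma_ne_zero_of_re_pos (by rw [hsre]; exact hz0)
  have hG2 : Complex.Gamma (s + γ) ≠ 0 :=
    Complex.Gamma_ne_zero_of_re_pos (by rw [Complex.add_re, hsre]; simp; linarith)
  rw [show (β : ℂ) + γ + ρ * z = s + γ by rw [hs]; ring, ← Complex.Gamma_ofReal]
  generalize (∫ x in (0 : ℝ)..1, (x : ℂ) ^ (s - 1) * (1 - (x : ℂ)) ^ ((γ : ℂ) - 1)) = B at hB ⊢
  field_simp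
  linear_combination (-Complex.Gamma z) * hB

/-- The fractional integral of order `γ` of the kernel of index `0 ≤ β < 1` depends only on
`β + γ`. -/
lemma fracKernel_div_Gamma_eq {ρ γ γ' β β' : ℝ} (hρ0 : 0 < ρ) (hρ : ρ < 1 / 2) (hγ : 0 < γ)
    (hγ' : 0 < γ') (hβ : β < 1) (hβ0 : 0 ≤ β) (hβ' : β' < 1) (hβ'0 : 0 ≤ β')
    (hsum : β + γ = β' + γ') {x : ℝ} (hx : 0 < x) :
    fracKernel ρ γ β x / Real.Gamma γ = fracKernel ρ γ' β' x / Real.Gamma γ' := by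
  set m := max β β' with hm
  have hm1 : m < 1 := max_lt hβ hβ'
  set σ : ℝ := (1 - m) / (2 * ρ) with hσ
  have hσ0 : 0 < σ := div_pos (by linarith) (by linarith)
  have hρσ : ρ * σ = (1 - m) / 2 := by rw [hσ]; field_simp
  have h1 : β ≤ m := le_max_left _ _
  have h2 : β' ≤ m := le_max_right _ _
  have key : ∀ {γ β : ℝ}, 0 < γ → 0 ≤ β → β ≤ m → ∀ z : ℂ, z.re = σ →
      HasMellin (fun x => ((fracKernel ρ γ β x / Real.Gamma γ : ℝ) : ℂ)) z
        (Complex.Gamma z / Complex.Gamma (((β + γ : ℝ) : ℂ) + ρ * z)) := by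
    intro γ β hγ h0 h1 z hz
    have h := hasMellin_fracKernel (β := β) hρ0 hρ hγ (z := z) (by rw [hz]; exact hσ0)
      (by rw [hz, hρσ]; linarith) (by rw [hz, hρσ]; linarith)
    have hG : (Real.Gamma γ : ℂ) ≠ 0 := by exact_mod_cast (Real.Gamma_pos_of_pos hγ).ne'
    have h' := hasMellin_const_smul h.1 ((Real.Gamma γ : ℂ)⁻¹)
    rw [h.2, smul_eq_mul, inv_mul_cancel_left₀ hG] at h'
    convert h' using 2
    · push_cast
      rw [div_eq_inv_mul, smul_eq_mul]
    · push_cast; ring_nf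
  refine eq_of_hasMellin (σ := σ) (fun y hy => ?_) (fun y hy => ?_)
    (key hγ hβ0 h1) (by rw [hsum]; exact key hγ' hβ'0 h2) hx
  · exact (continuousAt_fracKernel hρ0 hρ hγ hβ hy).div_const _
  · exact (continuousAt_fracKernel hρ0 hρ hγ' hβ' hy).div_const _

/-- The fractional integral of order `γ` of the kernel of index `0` is the kernel of index `γ`. -/
lemma fracKernel_zero_div_Gamma {ρ γ : ℝ} (hρ0 : 0 < ρ) (hρ : ρ < 1 / 2) (hγ : 0 < γ) (hγ1 : γ < 1)
    {x : ℝ} (hx : 0 < x) : fracKernel ρ γ 0 x / Real.Gamma γ = wrightNeg ρ γ x := by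
  set σ : ℝ := (1 - γ) / (2 * ρ) with hσ
  have hσ0 : 0 < σ := div_pos (by linarith) (by linarith)
  have hρσ : ρ * σ = (1 - γ) / 2 := by rw [hσ]; field_simp
  refine eq_of_hasMellin (σ := σ) (m := fun z => Complex.Gamma z / Complex.Gamma (γ + ρ * z))
    (fun y hy => (continuousAt_fracKernel hρ0 hρ hγ one_pos hy).div_const _)
    (fun y hy => (continuous_wrightNeg hρ0 hρ γ).continuousAt) (fun z hz => ?_) (fun z hz => ?_) hx
  · have h := hasMellin_fracKernel (β := 0) hρ0 hρ hγ (z := z) (by rw [hz]; exact hσ0)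
      (by rw [hz, hρσ]; linarith) (by rw [hz, hρσ]; linarith)
    have hG : (Real.Gamma γ : ℂ) ≠ 0 := by exact_mod_cast (Real.Gamma_pos_of_pos hγ).ne'
    have h' := hasMellin_const_smul h.1 ((Real.Gamma γ : ℂ)⁻¹)
    rw [h.2, smul_eq_mul, inv_mul_cancel_left₀ hG] at h'
    convert h' using 2
    · push_cast
      rw [div_eq_inv_mul, smul_eq_mul]
    · push_cast; ring_nf
  · exact hasMellin_wrightNeg hρ0 hρ (by rw [hz]; exact hσ0) (by rw [hz, hρσ]; linarith)

lemma rlIntegral_wrightKernel {ρ γ β x t : ℝ} (ht : 0 < t) :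
    rlIntegral γ (wrightKernel ρ β x) t =
      t ^ (β + γ - 1) * (fracKernel ρ γ β (x / t ^ ρ) / Real.Gamma γ) := by
  have h1 : (∫ τ in (0 : ℝ)..t, wrightKernel ρ β x τ / (t - τ) ^ (1 - γ)) =
      t * ∫ τ in (0 : ℝ)..1, wrightKernel ρ β x (t * τ) / (t - t * τ) ^ (1 - γ) := by
    rw [intervalIntegral.mul_integral_comp_mul_left
      (f := fun τ => wrightKernel ρ β x τ / (t - τ) ^ (1 - γ)), mul_zero, mul_one]
  have h2 : ∀ τ ∈ Ioo (0 : ℝ) 1, wrightKernel ρ β x (t * τ) / (t - t * τ) ^ (1 - γ) =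
      t ^ (β + γ - 2) * ((1 - τ) ^ (γ - 1) * wrightKernel ρ β (x / t ^ ρ) τ) := by
    intro τ hτ
    have hτ0 : 0 < τ := hτ.1
    have hτ1 : 0 < 1 - τ := by linarith [hτ.2]
    rw [wrightKernel, wrightKernel, show t - t * τ = t * (1 - τ) by ring,
      Real.mul_rpow ht.le hτ0.le, Real.mul_rpow ht.le hτ1.le, Real.mul_rpow ht.le hτ0.le, div_div,
      div_eq_mul_inv, mul_inv, ← Real.rpow_neg ht.le, ← Real.rpow_neg hτ1.le,
      show β + γ - 2 = (β - 1) + -(1 - γ) by ring, Real.rpow_add ht,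
      show -(1 - γ) = γ - 1 by ring]
    ring
  rw [rlIntegral, h1, intervalIntegral.integral_of_le zero_le_one, integral_Ioc_eq_integral_Ioo,
    setIntegral_congr_fun measurableSet_Ioo h2, integral_const_mul, ← fracKernel,
    show β + γ - 1 = (β + γ - 2) + 1 by ring, Real.rpow_add_one ht.ne']
  ring

lemma rlIntegrable_of_bounded {f : ℝ → ℝ} {C γ t : ℝ} (hγ : 0 < γ) (ht : 0 < t)
    (hm : AEStronglyMeasurable f (volume.restrict (Ioc 0 t)))
    (hC : ∀ τ ∈ Ioo 0 t, |f τ| ≤ C) : RLIntegrable γ f t := by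
  rw [RLIntegrable, intervalIntegrable_iff_integrableOn_Ioc_of_le ht.le,
    integrableOn_Ioc_iff_integrableOn_Ioo]
  have h1 : IntegrableOn (fun τ : ℝ => C * (t - τ) ^ (γ - 1)) (Ioo 0 t) := by
    rw [← integrableOn_Ioc_iff_integrableOn_Ioo,
      ← intervalIntegrable_iff_integrableOn_Ioc_of_le ht.le]
    have := (intervalIntegral.intervalIntegrable_rpow' (a := 0) (b := t) (r := γ - 1)
      (by linarith)).comp_sub_left t
    simpa using (this.symm.const_mul C)
  refine Integrable.mono' h1 ?_ ?_
  · simp_rw [div_eq_mul_inv]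
    exact (hm.mono_set Ioo_subset_Ioc_self).mul (Measurable.aestronglyMeasurable (by fun_prop))
  · filter_upwards [ae_restrict_mem measurableSet_Ioo] with τ hτ
    have h2 : 0 < t - τ := by linarith [hτ.2]
    rw [norm_div, Real.norm_eq_abs, Real.norm_of_nonneg (by positivity), div_eq_mul_inv,
      ← Real.rpow_neg h2.le, show -(1 - γ) = γ - 1 by ring]
    gcongr
    exact hC τ hτ

lemma rlIntegrable_wrightKernel {ρ γ β x t : ℝ} (hρ0 : 0 < ρ) (hρ : ρ < 1 / 2) (hβ : β < 1)
    (hγ : 0 < γ) (hx : 0 < x) (ht : 0 < t) : RLIntegrable γ (wrightKernel ρ β x) t := by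
  obtain ⟨C, -, h⟩ := exists_abs_wrightKernel_le hρ0 hρ hβ
  exact rlIntegrable_of_bounded hγ ht
    ((measurable_wrightKernel hρ0 hρ β).comp (measurable_prodMk_left (x := x))).aestronglyMeasurable
    fun τ hτ => h x τ hx hτ.1

/-- The fractional integral of order `γ` of the kernel of index `0` is the kernel of index `γ`. -/
lemma rlIntegral_wrightKernel_zero {ρ γ x t : ℝ} (hρ0 : 0 < ρ) (hρ : ρ < 1 / 2) (hγ : 0 < γ)
    (hγ1 : γ < 1) (hx : 0 < x) (ht : 0 < t) :
    rlIntegral γ (wrightKernel ρ 0 x) t = wrightKernel ρ γ x t := by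
  rw [rlIntegral_wrightKernel ht, fracKernel_zero_div_Gamma hρ0 hρ hγ hγ1 (by positivity),
    wrightKernel, zero_add]

/-- The fractional integral of order `2ρ` of the kernel of index `1 - ρ`, which is the kernel of
index `1 + ρ`, as an ordinary integral of the kernel of index `ρ`. -/
lemma rlIntegral_wrightKernel_one_sub {ρ x t : ℝ} (hρ0 : 0 < ρ) (hρ : ρ < 1 / 2) (hx : 0 < x)
    (ht : 0 < t) :
    rlIntegral (2 * ρ) (wrightKernel ρ (1 - ρ) x) t = ∫ τ in (0 : ℝ)..t, wrightKernel ρ ρ x τ := by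
  have h1 : rlIntegral 1 (wrightKernel ρ ρ x) t = ∫ τ in (0 : ℝ)..t, wrightKernel ρ ρ x τ := by
    simp [rlIntegral]
  rw [← h1, rlIntegral_wrightKernel ht, rlIntegral_wrightKernel ht,
    fracKernel_div_Gamma_eq (γ' := 1) (β' := ρ) hρ0 hρ (by linarith) one_pos (by linarith)
      (by linarith) (by linarith) hρ0.le (by ring) (by positivity)]
  ring_nf

lemma hasDerivAt_wrightKernel_time {ρ : ℝ} (hρ0 : 0 < ρ) (hρ : ρ < 1 / 2) (β x : ℝ) {t : ℝ}
    (ht : 0 < t) : HasDerivAt (wrightKernel ρ β x) (wrightKernel ρ (β - 1) x t) t := by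
  have h1 : HasDerivAt (fun t : ℝ => t ^ (β - 1)) ((β - 1) * t ^ (β - 1 - 1)) t :=
    Real.hasDerivAt_rpow_const (Or.inl ht.ne')
  have h2 : HasDerivAt (fun t : ℝ => t ^ ρ) (ρ * t ^ (ρ - 1)) t :=
    Real.hasDerivAt_rpow_const (Or.inl ht.ne')
  have hne : t ^ ρ ≠ 0 := by positivity
  have h3 := (hasDerivAt_wrightNeg hρ0 hρ β (x / t ^ ρ)).comp t ((hasDerivAt_const t x).fun_div h2 hne)
  refine (h1.mul h3).congr_deriv ?_
  rw [wrightKernel, wrightNeg_sub_one hρ0 hρ]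
  simp only [Function.comp]
  rw [Real.rpow_sub_one ht.ne' (β - 1), Real.rpow_sub_one ht.ne' ρ]
  field_simp
  ring

lemma hasDerivAt_wrightKernel_space {ρ : ℝ} (hρ0 : 0 < ρ) (hρ : ρ < 1 / 2) (β x : ℝ) {t : ℝ}
    (ht : 0 < t) :
    HasDerivAt (fun x => wrightKernel ρ β x t) (-wrightKernel ρ (β - ρ) x t) x := by
  have h3 := ((hasDerivAt_wrightNeg hρ0 hρ β (x / t ^ ρ)).comp x
    ((hasDerivAt_id x).div_const (t ^ ρ))).const_mul (t ^ (β - 1))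
  refine h3.congr_deriv ?_
  rw [wrightKernel, show β - ρ - 1 = (β - 1) - ρ by ring, Real.rpow_sub ht (β - 1)]
  ring

/-! ### Positivity of the kernels -/

lemma integrableOn_pow_mul_exp_neg_mul {s : ℝ} (hs : 0 < s) {a : ℝ} (ha : -1 < a) :
    IntegrableOn (fun t : ℝ => t ^ a * Real.exp (-(s * t))) (Ioi 0) := by
  have := integrableOn_rpow_mul_exp_neg_mul_rpow ha one_pos hs
  simpa [Real.rpow_one] using this

lemma integrableOn_pow_mul_exp_mul_of_bounded {f : ℝ → ℝ} {C : ℝ}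
    (hf : AEStronglyMeasurable f (volume.restrict (Ioi 0))) (hC : ∀ t, 0 < t → |f t| ≤ C)
    (n : ℕ) {s : ℝ} (hs : 0 < s) :
    IntegrableOn (fun t : ℝ => t ^ n * Real.exp (-(s * t)) * f t) (Ioi 0) := by
  have h1 := integrableOn_pow_mul_exp_neg_mul hs (a := n)
    (by linarith [(Nat.cast_nonneg n : (0 : ℝ) ≤ n)])
  simp only [Real.rpow_natCast] at h1
  refine Integrable.mul_bdd (c := C) h1 hf ?_
  filter_upwards [ae_restrict_mem measurableSet_Ioi] with t ht
  exact hC t ht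

/-- A bounded continuous function on `(0, ∞)` whose Laplace transform is completely monotone is
nonnegative. As in the Post–Widder inversion formula, the weight `(t exp(-t / t₀)) ^ n` concentrates
at `t₀`. -/
lemma nonneg_of_laplace_moments_nonneg {f : ℝ → ℝ} {C : ℝ} (hf : ContinuousOn f (Ioi 0))
    (hC : ∀ t, 0 < t → |f t| ≤ C)
    (h : ∀ (n : ℕ) (s : ℝ), 0 < s → 0 ≤ ∫ t in Ioi (0 : ℝ), t ^ n * Real.exp (-(s * t)) * f t)
    {t₀ : ℝ} (ht₀ : 0 < t₀) : 0 ≤ f t₀ := by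
  by_contra! hneg
  have hmeas : AEStronglyMeasurable f (volume.restrict (Ioi 0)) :=
    hf.aestronglyMeasurable measurableSet_Ioi
  have hC0 : 0 ≤ C := (abs_nonneg _).trans (hC t₀ ht₀)
  -- the peak function, normalised so that its maximum, attained at `t₀`, is `1`
  set c : ℝ → ℝ := fun t => (t / t₀) * Real.exp (1 - t / t₀) with hc
  have hcpos : ∀ t, 0 < t → 0 < c t := fun t ht => by simp only [hc]; positivity
  have hc_cont : Continuous c := by simp only [hc]; fun_prop
  have hct₀ : c t₀ = 1 := by simp [hc, ht₀.ne']
  have hderiv : ∀ t, HasDerivAt c ((1 / t₀) * Real.exp (1 - t / t₀) * (1 - t / t₀)) t := by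
    intro t
    have h1 : HasDerivAt (fun t : ℝ => t / t₀) (1 / t₀) t := (hasDerivAt_id t).div_const t₀
    have h2 := h1.mul ((h1.const_sub 1).exp)
    refine h2.congr_deriv ?_
    ring
  have hmono : MonotoneOn c (Icc 0 t₀) := by
    refine monotoneOn_of_deriv_nonneg (convex_Icc 0 t₀) hc_cont.continuousOn
      (fun t _ => (hderiv t).differentiableAt.differentiableWithinAt) fun t ht => ?_
    rw [interior_Icc] at ht
    have : 0 ≤ 1 - t / t₀ := by rw [sub_nonneg, div_le_one ht₀]; exact ht.2.le
    rw [(hderiv t).deriv]; positivity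
  have hanti : AntitoneOn c (Ici t₀) := by
    refine antitoneOn_of_deriv_nonpos (convex_Ici t₀) hc_cont.continuousOn
      (fun t _ => (hderiv t).differentiableAt.differentiableWithinAt) fun t ht => ?_
    rw [interior_Ici] at ht
    have : 1 - t / t₀ ≤ 0 := by rw [sub_nonpos, one_le_div ht₀]; exact le_of_lt ht
    rw [(hderiv t).deriv]
    exact mul_nonpos_of_nonneg_of_nonpos (by positivity) this
  have hlt : ∀ t, t ≠ t₀ → c t < 1 := by
    intro t ht
    have h1 : t / t₀ - 1 ≠ 0 := by
      rw [sub_ne_zero, Ne, div_eq_one_iff_eq ht₀.ne']; exact ht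
    have h2 := Real.add_one_lt_exp h1
    rw [sub_add_cancel] at h2
    calc c t < Real.exp (t / t₀ - 1) * Real.exp (1 - t / t₀) :=
          mul_lt_mul_of_pos_right h2 (Real.exp_pos _)
      _ = 1 := by rw [← Real.exp_add]; simp
  -- `f ≤ -δ` on a neighbourhood of `t₀`
  obtain ⟨δ, hδ0, hδ⟩ : ∃ δ > 0, f t₀ < -δ := ⟨-(f t₀) / 2, by linarith, by linarith⟩
  have hcont : ContinuousAt f t₀ := hf.continuousAt (Ioi_mem_nhds ht₀)
  obtain ⟨r₁, hr₁, hr₁'⟩ := Metric.eventually_nhds_iff.mp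
    ((hcont.eventually_lt_const hδ).and (lt_mem_nhds ht₀))
  set r := min (r₁ / 2) (t₀ / 2) with hr
  have hr0 : 0 < r := by positivity
  have hrt : r < t₀ := (min_le_right _ _).trans_lt (by linarith)
  have hfr : ∀ t, |t - t₀| ≤ r → f t < -δ := fun t ht =>
    (hr₁' (y := t) (by
      rw [Real.dist_eq]; exact ht.trans_lt ((min_le_left _ _).trans_lt (by linarith)))).1
  set q := max (c (t₀ - r)) (c (t₀ + r)) with hq
  have hq0 : 0 < q := lt_max_of_lt_left (hcpos _ (by linarith))
  have hq1 : q < 1 := max_lt (hlt _ (by linarith)) (hlt _ (by linarith))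
  have hout : ∀ t, 0 < t → r < |t - t₀| → c t ≤ q := by
    intro t ht htr
    rcases lt_abs.mp htr with h1 | h1
    · exact (hanti (mem_Ici.mpr (by linarith)) (mem_Ici.mpr (by linarith))
        (by linarith : t₀ + r ≤ t)).trans (le_max_right _ _)
    · exact (hmono ⟨ht.le, by linarith⟩ ⟨by linarith, by linarith⟩
        (by linarith : t ≤ t₀ - r)).trans (le_max_left _ _)
  obtain ⟨p, hqp, hp1⟩ := exists_between hq1
  have hp0 : 0 < p := hq0.trans hqp
  obtain ⟨r₂, hr₂, hr₂'⟩ := Metric.eventually_nhds_iff.mp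
    ((hc_cont.tendsto t₀).eventually_const_lt (by rw [hct₀]; exact hp1 : p < c t₀))
  set w := min (r₂ / 2) r with hw
  have hw0 : 0 < w := by positivity
  -- the integral against `c ^ (n + 1)` is nonnegative for all `n`
  have hint0 : ∀ n : ℕ, IntegrableOn (fun t => c t ^ (n + 1) * f t) (Ioi 0) ∧
      0 ≤ ∫ t in Ioi (0 : ℝ), c t ^ (n + 1) * f t := by
    intro n
    have e : ∀ t : ℝ, c t ^ (n + 1) * f t = (Real.exp 1 / t₀) ^ (n + 1) *
        (t ^ (n + 1) * Real.exp (-(((n + 1 : ℕ) / t₀) * t)) * f t) := by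
      intro t
      have : Real.exp (1 - t / t₀) ^ (n + 1) =
          Real.exp 1 ^ (n + 1) * Real.exp (-(((n + 1 : ℕ) / t₀) * t)) := by
        rw [← Real.exp_nat_mul, ← Real.exp_nat_mul, ← Real.exp_add]
        ring_nf
      simp only [hc]
      rw [mul_pow, this, div_pow, div_pow]
      ring
    have hs : 0 < ((n + 1 : ℕ) : ℝ) / t₀ := by positivity
    simp only [e]
    refine ⟨(integrableOn_pow_mul_exp_mul_of_bounded hmeas hC (n + 1) hs).const_mul _, ?_⟩
    rw [integral_const_mul]
    exact mul_nonneg (by positivity) (h _ _ hs)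
  have hcint : IntegrableOn c (Ioi 0) := by
    have h1 := (integrableOn_pow_mul_exp_neg_mul (s := 1 / t₀) (by positivity) (a := 1)
      (by norm_num)).const_mul (Real.exp 1 / t₀)
    refine h1.congr (Eventually.of_forall fun t => ?_)
    simp only [hc, Real.rpow_one]
    rw [sub_eq_add_neg, Real.exp_add]
    ring_nf
  set I := ∫ t in Ioi (0 : ℝ), c t with hI
  -- inside, `c ^ (n + 1) f ≤ -δ p ^ (n + 1)` near `t₀`; outside, `|c ^ (n + 1) f| ≤ C q ^ n c`
  have hbound : ∀ n : ℕ, δ * (2 * w) * p ^ (n + 1) ≤ C * q ^ n * I := by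
    intro n
    obtain ⟨hi, hn⟩ := hint0 n
    have hJ : IntegrableOn (fun t => (Icc (t₀ - w) (t₀ + w)).indicator
        (fun _ => δ * p ^ (n + 1)) t) (Ioi 0) := by
      refine Integrable.integrableOn ?_
      exact (integrable_indicator_iff measurableSet_Icc).mpr
        (continuousOn_const.integrableOn_compact isCompact_Icc)
    have hpt : ∀ t ∈ Ioi (0 : ℝ), c t ^ (n + 1) * f t + (Icc (t₀ - w) (t₀ + w)).indicator
        (fun _ => δ * p ^ (n + 1)) t ≤ C * q ^ n * c t := by
      intro t ht
      have ht : 0 < t := ht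
      have hct := hcpos t ht
      by_cases h1 : t ∈ Icc (t₀ - w) (t₀ + w)
      · rw [indicator_of_mem h1]
        have h2 : |t - t₀| ≤ w := abs_le.mpr ⟨by linarith [h1.1], by linarith [h1.2]⟩
        have h3 : p < c t := hr₂' (by
          rw [Real.dist_eq]; exact h2.trans_lt ((min_le_left _ _).trans_lt (by linarith)))
        have h4 := hfr t (h2.trans (min_le_right _ _))
        have h5 : p ^ (n + 1) ≤ c t ^ (n + 1) := by gcongr
        have h6 : c t ^ (n + 1) * f t ≤ c t ^ (n + 1) * (-δ) := by gcongr
        have h7 : 0 ≤ C * q ^ n * c t := by positivity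
        nlinarith
      · rw [indicator_of_notMem h1, add_zero]
        by_cases h2 : |t - t₀| ≤ r
        · have h4 := hfr t h2
          have h5 : c t ^ (n + 1) * f t ≤ 0 :=
            mul_nonpos_of_nonneg_of_nonpos (by positivity) (by linarith)
          exact h5.trans (by positivity)
        · have h3 := hout t ht (not_le.mp h2)
          calc c t ^ (n + 1) * f t ≤ c t ^ (n + 1) * C := by
                gcongr; exact (le_abs_self _).trans (hC t ht)
            _ = C * c t ^ n * c t := by ring
            _ ≤ C * q ^ n * c t := by gcongr
    have h8 := setIntegral_mono_on (hi.add hJ) (hcint.const_mul (C * q ^ n)) measurableSet_Ioi hpt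
    simp only [Pi.add_apply] at h8
    rw [integral_add hi hJ, integral_const_mul, ← hI, setIntegral_indicator measurableSet_Icc,
      inter_eq_self_of_subset_right (s := Ioi 0) (t := Icc (t₀ - w) (t₀ + w)) (fun t ht => by
        have : w ≤ r := min_le_right _ _
        exact mem_Ioi.mpr (by linarith [ht.1]))] at h8
    rw [setIntegral_const, Measure.real, Real.volume_Icc, ENNReal.toReal_ofReal (by linarith),
      smul_eq_mul] at h8
    nlinarith
  have hgrow : Tendsto (fun n : ℕ => (p / q) ^ n) atTop atTop :=
    tendsto_pow_atTop_atTop_of_one_lt ((one_lt_div hq0).mpr hqp)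
  obtain ⟨n, hn⟩ := (hgrow.eventually_gt_atTop (C * I / (δ * (2 * w) * p))).exists
  have h9 := hbound n
  rw [div_lt_iff₀ (by positivity), div_pow, div_mul_eq_mul_div, lt_div_iff₀ (by positivity)] at hn
  rw [pow_succ] at h9
  nlinarith

/-- `∫₀^∞ tⁿ exp(-s t) f(t) dt`, up to sign the `n`-th derivative of the Laplace transform of `f`. -/
noncomputable def laplaceMoment (f : ℝ → ℝ) (n : ℕ) (s : ℝ) : ℝ :=
  ∫ t in Ioi (0 : ℝ), t ^ n * Real.exp (-(s * t)) * f t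

lemma integrableOn_laplaceMoment_rpow {γ s : ℝ} (hγ : 0 < γ) (hs : 0 < s) (n : ℕ) :
    IntegrableOn (fun t : ℝ => t ^ n * Real.exp (-(s * t)) * t ^ (γ - 1)) (Ioi 0) := by
  refine (integrableOn_pow_mul_exp_neg_mul hs (a := n + (γ - 1))
    (by linarith [(Nat.cast_nonneg n : (0 : ℝ) ≤ n)])).congr ?_
  filter_upwards [ae_restrict_mem measurableSet_Ioi] with t ht
  rw [Real.rpow_add ht, Real.rpow_natCast]
  ring

/-- If `t f(t)` is a fractional integral of `f`, then by the binomial formula the Laplace moments of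
`f` satisfy a recursion with nonnegative coefficients. -/
lemma laplaceMoment_succ {f : ℝ → ℝ} {C c γ : ℝ} (hγ : 0 < γ)
    (hf : Measurable f) (hC : ∀ t, 0 < t → |f t| ≤ C)
    (heq : ∀ t, 0 < t → t * f t = c * rlIntegral γ f t) (n : ℕ) {s : ℝ} (hs : 0 < s) :
    laplaceMoment f (n + 1) s = c / Real.Gamma γ * ∑ k ∈ Finset.range (n + 1), (n.choose k : ℝ) *
      (laplaceMoment f k s * laplaceMoment (fun t => t ^ (γ - 1)) (n - k) s) := by
  set F : ℕ → ℝ → ℝ := fun k t => t ^ k * Real.exp (-(s * t)) * f t with hF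
  set G : ℕ → ℝ → ℝ := fun k t => t ^ k * Real.exp (-(s * t)) * t ^ (γ - 1) with hG
  have hFi : ∀ k, IntegrableOn (F k) (Ioi 0) := fun k =>
    integrableOn_pow_mul_exp_mul_of_bounded hf.aestronglyMeasurable hC k hs
  have hGi : ∀ k, IntegrableOn (G k) (Ioi 0) := fun k => integrableOn_laplaceMoment_rpow hγ hs k
  have hII : ∀ t, 0 < t → ∀ k j, IntervalIntegrable (fun τ => F k τ * G j (t - τ)) volume 0 t := by
    intro t ht k j
    have h1 : RLIntegrable γ
        (fun τ => F k τ * ((t - τ) ^ j * Real.exp (-(s * (t - τ))))) t := by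
      refine rlIntegrable_of_bounded (C := t ^ k * C * t ^ j) hγ ht ?_ fun τ hτ => ?_
      · exact Measurable.aestronglyMeasurable (by simp only [hF]; fun_prop)
      · have h2 : 0 < t - τ := by linarith [hτ.2]
        have hτ0 : 0 < τ := hτ.1
        have e1 : Real.exp (-(s * τ)) ≤ 1 := Real.exp_le_one_iff.mpr (by nlinarith)
        have e2 : Real.exp (-(s * (t - τ))) ≤ 1 := Real.exp_le_one_iff.mpr (by nlinarith)
        have hC0 : 0 ≤ C := (abs_nonneg _).trans (hC t ht)
        simp only [hF]
        rw [abs_mul, abs_mul, abs_of_pos (by positivity : 0 < τ ^ k * Real.exp (-(s * τ))),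
          abs_of_pos (by positivity : 0 < (t - τ) ^ j * Real.exp (-(s * (t - τ))))]
        calc _ ≤ (t ^ k * 1 * C) * (t ^ j * 1) := by
              gcongr
              · exact hτ.2.le
              · exact hC τ hτ.1
              · linarith
          _ = _ := by ring
    refine (h1.congr_uIoo fun τ hτ => ?_)
    rw [uIoo_of_le ht.le] at hτ
    have h2 : 0 < t - τ := by linarith [hτ.2]
    simp only [hG]
    rw [div_eq_mul_inv, ← Real.rpow_neg h2.le, show -(1 - γ) = γ - 1 by ring]
    ring
  have hpt : ∀ t ∈ Ioi (0 : ℝ), t ^ (n + 1) * Real.exp (-(s * t)) * f t =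
      c / Real.Gamma γ * ∑ k ∈ Finset.range (n + 1), (n.choose k : ℝ) *
        ∫ τ in (0 : ℝ)..t, F k τ * G (n - k) (t - τ) := by
    intro t ht
    have ht : 0 < t := ht
    have h1 : t ^ (n + 1) * Real.exp (-(s * t)) * f t =
        c / Real.Gamma γ * ((t ^ n * Real.exp (-(s * t))) *
          ∫ τ in (0 : ℝ)..t, f τ / (t - τ) ^ (1 - γ)) := by
      have := heq t ht
      rw [rlIntegral] at this
      rw [pow_succ]
      linear_combination (t ^ n * Real.exp (-(s * t))) * this
    rw [h1]
    congr 1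
    simp_rw [← intervalIntegral.integral_const_mul]
    rw [← intervalIntegral.integral_finsetSum fun k _ => (hII t ht k (n - k)).const_mul _]
    refine intervalIntegral.integral_congr_ae ?_
    refine Eventually.of_forall fun τ hτ => ?_
    rw [uIoc_of_le ht.le] at hτ
    have h2 : 0 ≤ t - τ := by linarith [hτ.2]
    have e1 : t ^ n = ∑ k ∈ Finset.range (n + 1), τ ^ k * (t - τ) ^ (n - k) * (n.choose k : ℝ) := by
      rw [← add_pow]; ring
    have e2 : Real.exp (-(s * t)) = Real.exp (-(s * τ)) * Real.exp (-(s * (t - τ))) := by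
      rw [← Real.exp_add]; ring_nf
    have e3 : f τ / (t - τ) ^ (1 - γ) = f τ * (t - τ) ^ (γ - 1) := by
      rw [div_eq_mul_inv, ← Real.rpow_neg h2, show -(1 - γ) = γ - 1 by ring]
    rw [e1, e2, e3, Finset.sum_mul, Finset.sum_mul]
    refine Finset.sum_congr rfl fun k _ => ?_
    simp only [hF, hG]
    ring
  have hconv : ∀ k j, IntegrableOn (fun t => ∫ τ in (0 : ℝ)..t, F k τ * G j (t - τ)) (Ioi 0) := by
    intro k j
    have := integrable_posConvolution (hFi k) (hGi j) (ContinuousLinearMap.mul ℝ ℝ)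
    rw [posConvolution, integrable_indicator_iff measurableSet_Ioi] at this
    exact this
  have hval : ∀ k j, ∫ t in Ioi (0 : ℝ), ∫ τ in (0 : ℝ)..t, F k τ * G j (t - τ) =
      laplaceMoment f k s * laplaceMoment (fun t => t ^ (γ - 1)) j s := fun k j =>
    integral_posConvolution (hFi k) (hGi j) (ContinuousLinearMap.mul ℝ ℝ)
  rw [laplaceMoment, setIntegral_congr_fun measurableSet_Ioi hpt, integral_const_mul,
    integral_finsetSum _ fun k _ => (hconv k (n - k)).const_mul _]
  simp_rw [integral_const_mul, hval]

lemma hasDerivAt_laplaceMoment_zero {f : ℝ → ℝ} {C : ℝ} (hf : Measurable f)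
    (hC : ∀ t, 0 < t → |f t| ≤ C) {s : ℝ} (hs : 0 < s) :
    HasDerivAt (laplaceMoment f 0) (-laplaceMoment f 1 s) s := by
  have hbd : ∀ n : ℕ, ∀ s, 0 < s →
      IntegrableOn (fun t : ℝ => t ^ n * Real.exp (-(s * t)) * f t) (Ioi 0) := fun n s hs =>
    integrableOn_pow_mul_exp_mul_of_bounded hf.aestronglyMeasurable hC n hs
  have h := hasDerivAt_integral_of_dominated_loc_of_deriv_le (μ := volume.restrict (Ioi (0 : ℝ)))
    (F := fun s t => t ^ 0 * Real.exp (-(s * t)) * f t) (x₀ := s) (s := Ioi (s / 2))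
    (F' := fun s t => -(t ^ 1 * Real.exp (-(s * t)) * f t))
    (bound := fun t => ‖t ^ 1 * Real.exp (-(s / 2 * t)) * f t‖)
    (Ioi_mem_nhds (by linarith)) ?_ (hbd 0 s hs) ?_ ?_ (hbd 1 (s / 2) (by linarith)).norm ?_
  · have h2 := h.2
    rw [integral_neg] at h2
    exact h2
  · exact Eventually.of_forall fun s => Measurable.aestronglyMeasurable (by fun_prop)
  · exact Measurable.aestronglyMeasurable (by fun_prop)
  · filter_upwards [ae_restrict_mem measurableSet_Ioi] with t ht y hy
    have ht : 0 < t := ht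
    have hy : s / 2 < y := hy
    simp only [norm_neg, norm_mul, Real.norm_eq_abs, Real.abs_exp]
    gcongr
  · refine Eventually.of_forall fun t y _ => ?_
    have h1 : HasDerivAt (fun s : ℝ => -(s * t)) (-t) y := by
      simpa using ((hasDerivAt_id y).mul_const t).fun_neg
    refine ((h1.exp.const_mul (t ^ 0)).mul_const (f t)).congr_deriv ?_
    ring

/-- The kernel of index `0` satisfies `t φ(t) = ρ x I^(1 - ρ) φ(t)`, here for `x = 1`. -/
lemma mul_wrightKernel_zero_one {ρ t : ℝ} (hρ0 : 0 < ρ) (hρ : ρ < 1 / 2) (ht : 0 < t) :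
    t * wrightKernel ρ 0 1 t = ρ * rlIntegral (1 - ρ) (wrightKernel ρ 0 1) t := by
  rw [rlIntegral_wrightKernel_zero hρ0 hρ (by linarith) (by linarith) one_pos ht, wrightKernel,
    wrightKernel]
  have h1 := wrightNeg_sub_one hρ0 hρ 1 (1 / t ^ ρ)
  rw [sub_self, zero_mul, zero_add] at h1
  rw [h1, show 1 - ρ - 1 = -ρ by ring, Real.rpow_neg ht.le, zero_sub, Real.rpow_neg_one]
  field_simp

lemma exists_laplaceMoment_zero_eq {f : ℝ → ℝ} {C ρ : ℝ} (hρ0 : 0 < ρ) (hρ : ρ < 1)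
    (hf : Measurable f) (hC : ∀ t, 0 < t → |f t| ≤ C)
    (heq : ∀ t, 0 < t → t * f t = ρ * rlIntegral (1 - ρ) f t) :
    ∃ A : ℝ, ∀ s, 0 < s → laplaceMoment f 0 s = A * Real.exp (-s ^ ρ) := by
  have hm1 : ∀ s, 0 < s → laplaceMoment f 1 s = ρ * s ^ (ρ - 1) * laplaceMoment f 0 s := by
    intro s hs
    have h1 := laplaceMoment_succ (by linarith : 0 < 1 - ρ) hf hC heq 0 hs
    have h2 : laplaceMoment (fun t => t ^ (1 - ρ - 1)) 0 s =
        s ^ (ρ - 1) * Real.Gamma (1 - ρ) := by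
      have h3 := Real.integral_rpow_mul_exp_neg_mul_Ioi (by linarith : 0 < 1 - ρ) hs
      rw [one_div, Real.inv_rpow hs.le, ← Real.rpow_neg hs.le, neg_sub] at h3
      rw [← h3, laplaceMoment]
      simp only [pow_zero, one_mul, mul_comm]
    have hG : Real.Gamma (1 - ρ) ≠ 0 := (Real.Gamma_pos_of_pos (by linarith)).ne'
    simp only [zero_add, Finset.range_one, Finset.sum_singleton, Nat.choose_self, Nat.cast_one,
      one_mul, Nat.sub_self, h2] at h1
    rw [h1]
    field_simp
  have hd : ∀ s ∈ Ioi (0 : ℝ), HasDerivAt (fun s => laplaceMoment f 0 s * Real.exp (s ^ ρ)) 0 s := by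
    intro s hs
    have hs : 0 < s := hs
    have h1 : HasDerivAt (fun s : ℝ => Real.exp (s ^ ρ)) (Real.exp (s ^ ρ) * (ρ * s ^ (ρ - 1))) s :=
      (Real.hasDerivAt_rpow_const (Or.inl hs.ne')).exp
    refine ((hasDerivAt_laplaceMoment_zero hf hC hs).mul h1).congr_deriv ?_
    rw [hm1 s hs]
    ring
  have hconst := fun s (hs : s ∈ Ioi (0 : ℝ)) => isOpen_Ioi.is_const_of_deriv_eq_zero
    (convex_Ioi (0 : ℝ)).isPreconnected (y := 1)
    (fun s hs => (hd s hs).differentiableAt.differentiableWithinAt) (fun s hs => (hd s hs).deriv)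
    hs (mem_Ioi.mpr one_pos)
  refine ⟨laplaceMoment f 0 1 * Real.exp (1 ^ ρ), fun s hs => ?_⟩
  rw [← hconst s (mem_Ioi.mpr hs), mul_assoc, ← Real.exp_add]
  simp

/-- The kernel of index `0` is nonnegative, and its Laplace transform is a positive multiple of
`exp(-s ^ ρ)`. -/
lemma wrightKernel_zero_nonneg {ρ : ℝ} (hρ0 : 0 < ρ) (hρ : ρ < 1 / 2) :
    (∀ t, 0 < t → 0 ≤ wrightKernel ρ 0 1 t) ∧ ∃ A : ℝ, 0 < A ∧ ∀ s, 0 < s →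
      laplaceMoment (wrightKernel ρ 0 1) 0 s = A * Real.exp (-s ^ ρ) := by
  set f := wrightKernel ρ 0 1 with hf
  obtain ⟨C₀, -, hC₀⟩ := exists_abs_wrightKernel_le (β := 0) hρ0 hρ one_pos
  set C := C₀ * (1 : ℝ) ^ (-(1 - 0) / ρ)
  have hC : ∀ t, 0 < t → |f t| ≤ C := fun t ht => hC₀ 1 t one_pos ht
  have hm : Measurable f := (measurable_wrightKernel hρ0 hρ 0).comp (measurable_prodMk_left (x := 1))
  have hcont : ContinuousOn f (Ioi 0) := continuousOn_wrightKernel hρ0 hρ 0 1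
  have heq : ∀ t, 0 < t → t * f t = ρ * rlIntegral (1 - ρ) f t := fun t ht =>
    mul_wrightKernel_zero_one hρ0 hρ ht
  obtain ⟨A, hA⟩ := exists_laplaceMoment_zero_eq hρ0 (by linarith) hm hC heq
  -- all the moments have the sign of `A`
  have hmom : ∀ ε : ℝ, 0 ≤ ε * A → ∀ n s, 0 < s → 0 ≤ ε * laplaceMoment f n s := by
    intro ε hε n
    induction n using Nat.strong_induction_on with
    | _ n ih =>
      intro s hs
      cases n with
      | zero =>
        rw [hA s hs, ← mul_assoc]; positivity
      | succ n =>
        rw [laplaceMoment_succ (by linarith : 0 < 1 - ρ) hm hC heq n hs, mul_left_comm,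
          Finset.mul_sum]
        have hG : 0 < Real.Gamma (1 - ρ) := Real.Gamma_pos_of_pos (by linarith)
        refine mul_nonneg (by positivity) (Finset.sum_nonneg fun k hk => ?_)
        have h1 := ih k (by simpa using hk) s hs
        have h2 : 0 ≤ laplaceMoment (fun t => t ^ (1 - ρ - 1)) (n - k) s :=
          setIntegral_nonneg measurableSet_Ioi fun t ht => by
            have : 0 < t := ht
            positivity
        calc (0 : ℝ) ≤ (n.choose k : ℝ) * ((ε * laplaceMoment f k s) *
              laplaceMoment (fun t => t ^ (1 - ρ - 1)) (n - k) s) := by positivity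
          _ = _ := by ring
  have hsign : ∀ ε : ℝ, 0 ≤ ε * A → ∀ t, 0 < t → 0 ≤ ε * f t := by
    intro ε hε t ht
    refine nonneg_of_laplace_moments_nonneg (f := fun t => ε * f t) (C := |ε| * C)
      (continuousOn_const.mul hcont) (fun t ht => ?_) (fun n s hs => ?_) ht
    · rw [abs_mul]
      exact mul_le_mul_of_nonneg_left (hC t ht) (abs_nonneg ε)
    · refine (hmom ε hε n s hs).trans_eq ?_
      rw [laplaceMoment, ← integral_const_mul]
      refine integral_congr_ae (Eventually.of_forall fun t => ?_)
      simp only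
      ring
  -- `f` is positive for large times, since `W(0; -ρ; 1 - ρ) = 1 / Γ(1 - ρ) > 0`
  obtain ⟨t₁, ht₁, hft₁⟩ : ∃ t, 0 < t ∧ 0 < f t := by
    have h0 : 0 < wrightNeg ρ (1 - ρ) 0 := by
      rw [wrightNeg_zero]
      exact inv_pos.mpr (Real.Gamma_pos_of_pos (by linarith))
    have h1 : Tendsto (fun t : ℝ => 1 / t ^ ρ) atTop (𝓝 0) := by
      simp only [one_div]
      exact (tendsto_rpow_atTop hρ0).inv_tendsto_atTop
    have h2 := ((continuous_wrightNeg hρ0 hρ (1 - ρ)).tendsto 0).comp h1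
    obtain ⟨t, ht, ht0⟩ := ((h2.eventually_const_lt h0).and (eventually_gt_atTop 0)).exists
    refine ⟨t, ht0, ?_⟩
    have h3 := wrightNeg_sub_one hρ0 hρ 1 (1 / t ^ ρ)
    rw [sub_self, zero_mul, zero_add] at h3
    rw [hf, wrightKernel, h3]
    simp only [Function.comp] at ht
    positivity
  have hApos : 0 < A := by
    by_contra! hA0
    have := hsign (-1) (by linarith) t₁ ht₁
    linarith
  exact ⟨fun t ht => by simpa using hsign 1 (by linarith) t ht, A, hApos, hA⟩

/-- The kernel of index `0` does not vanish on any interval `(0, t₀)`: otherwise its Laplace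
transform would be `O(exp(-s t₀))`. -/
lemma exists_wrightKernel_zero_pos {ρ : ℝ} (hρ0 : 0 < ρ) (hρ : ρ < 1 / 2) {t₀ : ℝ} (ht₀ : 0 < t₀) :
    ∃ t, 0 < t ∧ t < t₀ ∧ 0 < wrightKernel ρ 0 1 t := by
  obtain ⟨hnn, A, hA, hL⟩ := wrightKernel_zero_nonneg hρ0 hρ
  by_contra! hzero
  obtain ⟨C₀, -, hC₀⟩ := exists_abs_wrightKernel_le (β := 0) hρ0 hρ one_pos
  have hm : Measurable (wrightKernel ρ 0 1) :=
    (measurable_wrightKernel hρ0 hρ 0).comp (measurable_prodMk_left (x := 1))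
  have hint : ∀ s, 0 < s → IntegrableOn
      (fun t : ℝ => t ^ 0 * Real.exp (-(s * t)) * wrightKernel ρ 0 1 t) (Ioi 0) := fun s hs =>
    integrableOn_pow_mul_exp_mul_of_bounded hm.aestronglyMeasurable
      (fun t ht => hC₀ 1 t one_pos ht) 0 hs
  have hle : ∀ s, 1 ≤ s → A * Real.exp (-s ^ ρ) ≤
      Real.exp (-((s - 1) * t₀)) * (A * Real.exp (-1)) := by
    intro s hs
    have h1 : A * Real.exp (-1) = laplaceMoment (wrightKernel ρ 0 1) 0 1 := by
      rw [hL 1 one_pos, Real.one_rpow]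
    rw [h1, ← hL s (by linarith), laplaceMoment, laplaceMoment, ← integral_const_mul]
    refine setIntegral_mono_on (hint s (by linarith)) ((hint 1 one_pos).const_mul _)
      measurableSet_Ioi fun t ht => ?_
    have ht : 0 < t := ht
    have hft := hnn t ht
    rcases lt_or_ge t t₀ with h2 | h2
    · have h3 : wrightKernel ρ 0 1 t = 0 := le_antisymm (hzero t ht h2) hft
      simp [h3]
    · rw [← mul_assoc, pow_zero, one_mul, one_mul, ← Real.exp_add]
      gcongr
      nlinarith
  -- at `s = r ^ 2` the comparison reads `(r ^ 2 - 1) t₀ + 1 ≤ r ^ (2ρ) ≤ r`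
  set r := 1 + 1 / t₀ with hr
  have hr1 : 1 ≤ r := by rw [hr]; linarith [one_div_pos.mpr ht₀]
  have h4 := hle (r ^ 2) (by nlinarith)
  have h5 : Real.exp (-(r ^ 2) ^ ρ) ≤ Real.exp (-((r ^ 2 - 1) * t₀) + -1) := by
    rw [Real.exp_add]
    refine le_of_mul_le_mul_left ?_ hA
    linarith
  rw [Real.exp_le_exp] at h5
  have h6 : (r ^ 2) ^ ρ ≤ r := by
    rw [← Real.rpow_natCast, ← Real.rpow_mul (by linarith)]
    calc r ^ (((2 : ℕ) : ℝ) * ρ) ≤ r ^ (1 : ℝ) :=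
          Real.rpow_le_rpow_of_exponent_le hr1 (by push_cast; linarith)
      _ = r := Real.rpow_one r
  have h7 : (r - 1) * t₀ = 1 := by rw [hr]; field_simp; ring
  nlinarith

lemma wrightNeg_zero_eq_wrightKernel {ρ y : ℝ} (hρ0 : 0 < ρ) (hy : 0 < y) :
    wrightNeg ρ 0 y = y ^ (-ρ⁻¹) * wrightKernel ρ 0 1 (y ^ (-ρ⁻¹)) := by
  have ht : 0 < y ^ (-ρ⁻¹) := by positivity
  have h1 : (y ^ (-ρ⁻¹)) ^ ρ = y⁻¹ := by
    rw [← Real.rpow_mul hy.le, neg_mul, inv_mul_cancel₀ hρ0.ne', Real.rpow_neg_one]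
  rw [wrightKernel, h1, one_div, inv_inv, zero_sub, Real.rpow_neg_one, mul_inv_cancel_left₀ ht.ne']

lemma wrightNeg_zero_nonneg {ρ y : ℝ} (hρ0 : 0 < ρ) (hρ : ρ < 1 / 2) (hy : 0 < y) :
    0 ≤ wrightNeg ρ 0 y := by
  rw [wrightNeg_zero_eq_wrightKernel hρ0 hy]
  exact mul_nonneg (by positivity) ((wrightKernel_zero_nonneg hρ0 hρ).1 _ (by positivity))

lemma wrightNeg_nonneg {ρ γ y : ℝ} (hρ0 : 0 < ρ) (hρ : ρ < 1 / 2) (hγ : 0 < γ) (hγ1 : γ < 1)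
    (hy : 0 < y) : 0 ≤ wrightNeg ρ γ y := by
  rw [← fracKernel_zero_div_Gamma hρ0 hρ hγ hγ1 hy]
  refine div_nonneg (setIntegral_nonneg measurableSet_Ioo fun τ hτ => ?_)
    (Real.Gamma_pos_of_pos hγ).le
  have hτ0 : 0 < τ := hτ.1
  have hτ1 : 0 < 1 - τ := by linarith [hτ.2]
  have := wrightNeg_zero_nonneg hρ0 hρ (y := y / τ ^ ρ) (by positivity)
  rw [wrightKernel]
  positivity

lemma wrightNeg_zero_eq {ρ : ℝ} (hρ0 : 0 < ρ) (hρ : ρ < 1 / 2) (y : ℝ) :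
    wrightNeg ρ 0 y = ρ * y * wrightNeg ρ (1 - ρ) y := by
  have h := wrightNeg_sub_one hρ0 hρ 1 y
  rwa [sub_self, zero_mul, zero_add] at h

/-- The Mainardi function is nonincreasing on `[0, ∞)`, its derivative being
`-W(-y; -ρ; 1 - 2ρ) ≤ 0`. -/
lemma antitoneOn_mainardi {ρ : ℝ} (hρ0 : 0 < ρ) (hρ : ρ < 1 / 2) :
    AntitoneOn (wrightNeg ρ (1 - ρ)) (Ici 0) := by
  refine antitoneOn_of_deriv_nonpos (convex_Ici 0) (continuous_wrightNeg hρ0 hρ _).continuousOn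
    (fun y _ => (hasDerivAt_wrightNeg hρ0 hρ _ y).differentiableAt.differentiableWithinAt)
    fun y hy => ?_
  rw [interior_Ici] at hy
  rw [(hasDerivAt_wrightNeg hρ0 hρ _ y).deriv, neg_nonpos]
  exact wrightNeg_nonneg hρ0 hρ (by linarith) (by linarith) hy

/-- The Mainardi function is positive on `(0, ∞)`: it is nonincreasing, and positive at arbitrarily
large points. -/
lemma mainardi_pos {ρ y : ℝ} (hρ0 : 0 < ρ) (hρ : ρ < 1 / 2) (hy : 0 < y) :
    0 < wrightNeg ρ (1 - ρ) y := by
  have ht₀ : 0 < y ^ (-ρ⁻¹) := by positivity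
  obtain ⟨t, ht, htt, hpos⟩ := exists_wrightKernel_zero_pos hρ0 hρ ht₀
  have h1 : t ^ ρ < y⁻¹ := by
    have := Real.rpow_lt_rpow ht.le htt hρ0
    rwa [← Real.rpow_mul hy.le, neg_mul, inv_mul_cancel₀ hρ0.ne', Real.rpow_neg_one] at this
  have h2 : y < 1 / t ^ ρ := by
    rw [lt_one_div hy (by positivity), one_div]; exact h1
  rw [wrightKernel, wrightNeg_zero_eq hρ0 hρ] at hpos
  have h3 : 0 < wrightNeg ρ (1 - ρ) (1 / t ^ ρ) := by
    by_contra! h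
    have : t ^ ((0 : ℝ) - 1) * (ρ * (1 / t ^ ρ) * wrightNeg ρ (1 - ρ) (1 / t ^ ρ)) ≤ 0 :=
      mul_nonpos_of_nonneg_of_nonpos (by positivity)
        (mul_nonpos_of_nonneg_of_nonpos (by positivity) h)
    linarith
  exact h3.trans_le (antitoneOn_mainardi hρ0 hρ hy.le (hy.trans h2).le h2.le)

lemma wrightNeg_one_zero (ρ : ℝ) : wrightNeg ρ 1 0 = 1 := by
  rw [wrightNeg_zero, Real.Gamma_one, inv_one]

lemma strictAntiOn_wrightNeg_one {ρ : ℝ} (hρ0 : 0 < ρ) (hρ : ρ < 1 / 2) :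
    StrictAntiOn (wrightNeg ρ 1) (Ici 0) := by
  refine strictAntiOn_of_deriv_neg (convex_Ici 0) (continuous_wrightNeg hρ0 hρ _).continuousOn
    fun y hy => ?_
  rw [interior_Ici] at hy
  rw [(hasDerivAt_wrightNeg hρ0 hρ _ y).deriv, neg_lt_zero]
  exact mainardi_pos hρ0 hρ hy

lemma wrightNeg_one_lt_one {ρ y : ℝ} (hρ0 : 0 < ρ) (hρ : ρ < 1 / 2) (hy : 0 < y) :
    wrightNeg ρ 1 y < 1 := by
  have := strictAntiOn_wrightNeg_one hρ0 hρ (mem_Ici.mpr le_rfl) (mem_Ici.mpr hy.le) hy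
  rwa [wrightNeg_one_zero] at this

/-- The comparison `Γ(1 - ρ) W(-y; -ρ; 1 - ρ) < Γ(ρ) W(-y; -ρ; ρ)`: both sides are fractional
integrals of the same positive kernel, with the weights `(1 - τ) ^ (-ρ) < (1 - τ) ^ (ρ - 1)`. -/
lemma Gamma_mul_mainardi_lt {ρ y : ℝ} (hρ0 : 0 < ρ) (hρ : ρ < 1 / 2) (hy : 0 < y) :
    Real.Gamma (1 - ρ) * wrightNeg ρ (1 - ρ) y < Real.Gamma ρ * wrightNeg ρ ρ y := by
  have hG : ∀ γ, 0 < γ → γ < 1 → Real.Gamma γ * wrightNeg ρ γ y = fracKernel ρ γ 0 y := by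
    intro γ hγ hγ1
    rw [← fracKernel_zero_div_Gamma hρ0 hρ hγ hγ1 hy,
      mul_div_cancel₀ _ (Real.Gamma_pos_of_pos hγ).ne']
  rw [hG _ (by linarith) (by linarith), hG _ hρ0 (by linarith)]
  have hint : ∀ γ : ℝ, 0 < γ → IntervalIntegrable
      (fun τ => (1 - τ) ^ (γ - 1) * wrightKernel ρ 0 y τ) volume 0 1 := by
    intro γ hγ
    refine (rlIntegrable_wrightKernel (γ := γ) hρ0 hρ one_pos hγ hy one_pos).congr_uIoo
      fun τ hτ => ?_
    rw [uIoo_of_le zero_le_one] at hτ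
    have hτ1 : 0 < 1 - τ := by linarith [hτ.2]
    beta_reduce
    rw [div_eq_mul_inv, ← Real.rpow_neg hτ1.le, show -(1 - γ) = γ - 1 by ring, mul_comm]
  have hfrac : ∀ γ, fracKernel ρ γ 0 y =
      ∫ τ in (0 : ℝ)..1, (1 - τ) ^ (γ - 1) * wrightKernel ρ 0 y τ := fun γ => by
    rw [fracKernel, intervalIntegral.integral_of_le zero_le_one, integral_Ioc_eq_integral_Ioo]
  rw [hfrac, hfrac, ← sub_pos,
    ← intervalIntegral.integral_sub (hint _ hρ0) (hint _ (by linarith))]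
  refine intervalIntegral.intervalIntegral_pos_of_pos_on
    ((hint _ hρ0).sub (hint _ (by linarith))) (fun τ hτ => ?_) one_pos
  have hτ0 : 0 < τ := hτ.1
  have hτ1 : 0 < 1 - τ := by linarith [hτ.2]
  have hK : 0 < wrightKernel ρ 0 y τ := by
    have := mainardi_pos hρ0 hρ (y := y / τ ^ ρ) (by positivity)
    rw [wrightKernel, wrightNeg_zero_eq hρ0 hρ]
    positivity
  have hlt : (1 - τ) ^ (1 - ρ - 1) < (1 - τ) ^ (ρ - 1) :=
    Real.rpow_lt_rpow_of_exponent_gt hτ1 (by linarith) (by linarith)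
  rw [← sub_mul]
  exact mul_pos (sub_pos.mpr hlt) hK

/-! ### The two transcendental equations -/

/-- The left-hand side `y (1 - W(-y; -ρ; 1))` of both equations, with `y = 2 x`. -/
noncomputable def stefanLHS (ρ y : ℝ) : ℝ := y * (1 - wrightNeg ρ 1 y)

lemma strictMonoOn_stefanLHS {ρ : ℝ} (hρ0 : 0 < ρ) (hρ : ρ < 1 / 2) :
    StrictMonoOn (stefanLHS ρ) (Ioi 0) := by
  intro a ha b hb hab
  have ha : 0 < a := ha
  have h1 := strictAntiOn_wrightNeg_one hρ0 hρ (mem_Ici.mpr ha.le) (mem_Ici.mpr (ha.trans hab).le)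
    hab
  have h2 := wrightNeg_one_lt_one hρ0 hρ ha
  exact mul_lt_mul'' hab (by linarith) ha.le (by linarith)

lemma existsUnique_stefanLHS_eq {ρ : ℝ} (hρ0 : 0 < ρ) (hρ : ρ < 1 / 2) {R : ℝ → ℝ}
    (hR : Continuous R) (hR0 : 0 < R 0) (hanti : AntitoneOn R (Ici 0)) :
    ∃ y : ℝ, (0 < y ∧ stefanLHS ρ y = R y) ∧ ∀ z, 0 < z → stefanLHS ρ z = R z → z = y := by
  have hc : Continuous (fun y => stefanLHS ρ y - R y) :=
    (continuous_id.mul (continuous_const.sub (continuous_wrightNeg hρ0 hρ 1))).sub hR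
  have h1 := wrightNeg_one_lt_one hρ0 hρ one_pos
  have h1' : 0 < 1 - wrightNeg ρ 1 1 := by linarith
  set b := max 1 (R 0 / (1 - wrightNeg ρ 1 1)) with hb
  have hb1 : 1 ≤ b := le_max_left _ _
  have hbig : 0 ≤ stefanLHS ρ b - R b := by
    have h2 : R b ≤ R 0 := hanti (mem_Ici.mpr le_rfl) (mem_Ici.mpr (by linarith)) (by linarith)
    have h3 : R 0 ≤ b * (1 - wrightNeg ρ 1 1) := by
      rw [← div_le_iff₀ h1']; exact le_max_right _ _
    have h4 : wrightNeg ρ 1 b ≤ wrightNeg ρ 1 1 :=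
      (strictAntiOn_wrightNeg_one hρ0 hρ).antitoneOn (mem_Ici.mpr zero_le_one)
        (mem_Ici.mpr (by linarith)) hb1
    have h5 : b * (1 - wrightNeg ρ 1 1) ≤ stefanLHS ρ b :=
      mul_le_mul_of_nonneg_left (by linarith) (by linarith)
    linarith
  have h0 : stefanLHS ρ 0 - R 0 < 0 := by simp [stefanLHS, hR0]
  obtain ⟨y, hy, hy0⟩ := intermediate_value_Icc (by linarith : (0 : ℝ) ≤ b) hc.continuousOn
    ⟨h0.le, hbig⟩
  have hypos : 0 < y := by
    refine lt_of_le_of_ne hy.1 ?_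
    rintro rfl
    exact h0.ne hy0
  have hlt : ∀ a b : ℝ, 0 < a → a < b → stefanLHS ρ a - R a < stefanLHS ρ b - R b := by
    intro a b ha hab
    have h2 := strictMonoOn_stefanLHS hρ0 hρ (mem_Ioi.mpr ha) (mem_Ioi.mpr (ha.trans hab)) hab
    have h3 := hanti (mem_Ici.mpr ha.le) (mem_Ici.mpr (ha.trans hab).le) hab.le
    linarith
  refine ⟨y, ⟨hypos, sub_eq_zero.mp hy0⟩, fun z hz hzR => ?_⟩
  have hz0 : stefanLHS ρ z - R z = 0 := sub_eq_zero.mpr hzR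
  have hy0 : stefanLHS ρ y - R y = 0 := hy0
  rcases lt_trichotomy z y with h | h | h
  · have := hlt z y hz h; linarith
  · exact h
  · have := hlt y z hypos h; linarith

/-- The contiguous relation `W(-y; -ρ; ρ) = ρ (y W(-y; -ρ; 1) + W(-y; -ρ; 1 + ρ))`. -/
lemma wrightNeg_self_eq {ρ : ℝ} (hρ0 : 0 < ρ) (hρ : ρ < 1 / 2) (y : ℝ) :
    wrightNeg ρ ρ y = ρ * (y * wrightNeg ρ 1 y + wrightNeg ρ (1 + ρ) y) := by
  have h := wrightNeg_sub_one hρ0 hρ (1 + ρ) y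
  rw [show 1 + ρ - 1 = ρ by ring, show 1 + ρ - ρ = 1 by ring] at h
  rw [h]; ring

/-- The derivative of the right-hand side of the second equation is `-y W(-y; -ρ; 1 - ρ)`. -/
lemma antitoneOn_xiRHS {ρ : ℝ} (hρ0 : 0 < ρ) (hρ : ρ < 1 / 2) :
    AntitoneOn (fun y => y * wrightNeg ρ 1 y + wrightNeg ρ (1 + ρ) y) (Ici 0) := by
  have hd : ∀ y, HasDerivAt (fun y => y * wrightNeg ρ 1 y + wrightNeg ρ (1 + ρ) y)
      (-(y * wrightNeg ρ (1 - ρ) y)) y := by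
    intro y
    refine (((hasDerivAt_id y).mul (hasDerivAt_wrightNeg hρ0 hρ 1 y)).add
      (hasDerivAt_wrightNeg hρ0 hρ (1 + ρ) y)).congr_deriv ?_
    rw [show 1 + ρ - ρ = 1 by ring, id]
    ring
  refine antitoneOn_of_deriv_nonpos (convex_Ici 0)
    (fun y _ => (hd y).continuousAt.continuousWithinAt)
    (fun y _ => (hd y).differentiableAt.differentiableWithinAt) fun y hy => ?_
  rw [interior_Ici] at hy
  rw [(hd y).deriv, neg_nonpos]
  have hy : 0 < y := hy
  have := mainardi_pos hρ0 hρ hy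
  positivity

lemma isEtaRoot_iff {α x : ℝ} : IsEtaRoot α x ↔ 0 < x ∧ stefanLHS (α / 2) (2 * x) =
    wrightNeg (α / 2) (1 - α / 2) (2 * x) *
      (Real.Gamma (1 - α / 2) / Real.Gamma (1 + α / 2)) := by
  rw [IsEtaRoot, mainardi, stefanLHS, wrightNeg, wrightNeg, neg_mul]

lemma isXiRoot_iff {α x : ℝ} : IsXiRoot α x ↔ 0 < x ∧ stefanLHS (α / 2) (2 * x) =
    2 * x * wrightNeg (α / 2) 1 (2 * x) + wrightNeg (α / 2) (1 + α / 2) (2 * x) := by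
  rw [IsXiRoot, stefanLHS, wrightNeg, wrightNeg, neg_mul]

lemma existsUnique_isEtaRoot {α : ℝ} (hα0 : 0 < α) (hα1 : α < 1) :
    ∃ η, IsEtaRoot α η ∧ ∀ y, IsEtaRoot α y → y = η := by
  have hρ0 : 0 < α / 2 := by linarith
  have hρ : α / 2 < 1 / 2 := by linarith
  have hG1 : 0 < Real.Gamma (1 - α / 2) := Real.Gamma_pos_of_pos (by linarith)
  have hG2 : 0 < Real.Gamma (1 + α / 2) := Real.Gamma_pos_of_pos (by linarith)
  obtain ⟨y, ⟨hy0, hy⟩, huniq⟩ := existsUnique_stefanLHS_eq hρ0 hρ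
    (R := fun y => wrightNeg (α / 2) (1 - α / 2) y *
      (Real.Gamma (1 - α / 2) / Real.Gamma (1 + α / 2)))
    ((continuous_wrightNeg hρ0 hρ _).mul continuous_const)
    (by rw [wrightNeg_zero]; positivity)
    (fun a ha b hb hab => mul_le_mul_of_nonneg_right (antitoneOn_mainardi hρ0 hρ ha hb hab)
      (by positivity))
  refine ⟨y / 2, isEtaRoot_iff.mpr ⟨by linarith, ?_⟩, fun z hz => ?_⟩
  · rw [mul_div_cancel₀ y two_ne_zero]; exact hy
  · rw [isEtaRoot_iff] at hz
    have := huniq (2 * z) (by linarith [hz.1]) hz.2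
    linarith

lemma existsUnique_isXiRoot {α : ℝ} (hα0 : 0 < α) (hα1 : α < 1) :
    ∃ ξ, IsXiRoot α ξ ∧ ∀ y, IsXiRoot α y → y = ξ := by
  have hρ0 : 0 < α / 2 := by linarith
  have hρ : α / 2 < 1 / 2 := by linarith
  have hG2 : 0 < Real.Gamma (1 + α / 2) := Real.Gamma_pos_of_pos (by linarith)
  obtain ⟨y, ⟨hy0, hy⟩, huniq⟩ := existsUnique_stefanLHS_eq hρ0 hρ
    (R := fun y => y * wrightNeg (α / 2) 1 y + wrightNeg (α / 2) (1 + α / 2) y)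
    ((continuous_id.mul (continuous_wrightNeg hρ0 hρ _)).add (continuous_wrightNeg hρ0 hρ _))
    (by rw [wrightNeg_zero _ (1 + α / 2)]; simpa using hG2) (antitoneOn_xiRHS hρ0 hρ)
  refine ⟨y / 2, isXiRoot_iff.mpr ⟨by linarith, ?_⟩, fun z hz => ?_⟩
  · rw [mul_div_cancel₀ y two_ne_zero]; exact hy
  · rw [isXiRoot_iff] at hz
    have := huniq (2 * z) (by linarith [hz.1]) hz.2
    linarith

/-- The two equations have no common root, since their right-hand sides differ on `(0, ∞)` by
`Gamma_mul_mainardi_lt`. -/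
lemma isEtaRoot_ne_isXiRoot {α η ξ : ℝ} (hα0 : 0 < α) (hα1 : α < 1) (hη : IsEtaRoot α η)
    (hξ : IsXiRoot α ξ) : η ≠ ξ := by
  rintro rfl
  have hρ0 : 0 < α / 2 := by linarith
  have hρ : α / 2 < 1 / 2 := by linarith
  rw [isEtaRoot_iff] at hη
  rw [isXiRoot_iff] at hξ
  have h1 := Gamma_mul_mainardi_lt hρ0 hρ (y := 2 * η) (by linarith [hη.1])
  have h2 : Real.Gamma (1 + α / 2) = α / 2 * Real.Gamma (α / 2) := by
    rw [add_comm]; exact Real.Gamma_add_one hρ0.ne'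
  have hG : 0 < Real.Gamma (α / 2) := Real.Gamma_pos_of_pos hρ0
  have h3 := hη.2.symm.trans hξ.2
  rw [wrightNeg_self_eq hρ0 hρ, ← h3, h2] at h1
  have h4 : Real.Gamma (α / 2) * (α / 2 * (wrightNeg (α / 2) (1 - α / 2) (2 * η) *
      (Real.Gamma (1 - α / 2) / (α / 2 * Real.Gamma (α / 2))))) =
      Real.Gamma (1 - α / 2) * wrightNeg (α / 2) (1 - α / 2) (2 * η) := by
    field_simp
  exact h1.ne h4.symm

/-! ### Verification of the two Stefan problems -/

lemma RLIntegrable.const_mul_congr {γ t c : ℝ} {f g : ℝ → ℝ} (ht : 0 < t) (h : RLIntegrable γ g t)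
    (hfg : ∀ τ ∈ Ioo 0 t, f τ = c * g τ) : RLIntegrable γ f t := by
  refine (h.const_mul c).congr_uIoo fun τ hτ => ?_
  rw [uIoo_of_le ht.le] at hτ
  simp only [hfg τ hτ, mul_div_assoc]

lemma rlIntegral_const_mul_congr {γ t c : ℝ} {f g : ℝ → ℝ} (ht : 0 < t)
    (hfg : ∀ τ ∈ Ioo 0 t, f τ = c * g τ) : rlIntegral γ f t = c * rlIntegral γ g t := by
  have : ∫ τ in (0 : ℝ)..t, f τ / (t - τ) ^ (1 - γ) =
      c * ∫ τ in (0 : ℝ)..t, g τ / (t - τ) ^ (1 - γ) := by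
    rw [← intervalIntegral.integral_const_mul, intervalIntegral.integral_of_le ht.le,
      intervalIntegral.integral_of_le ht.le, integral_Ioc_eq_integral_Ioo,
      integral_Ioc_eq_integral_Ioo]
    refine setIntegral_congr_fun measurableSet_Ioo fun τ hτ => ?_
    simp only [hfg τ hτ, mul_div_assoc]
  rw [rlIntegral, rlIntegral, this]
  ring

/-- The fractional integral of a power. -/
lemma rlIntegral_rpow {b γ t : ℝ} (hb : 0 < b) (hγ : 0 < γ) (ht : 0 < t) :
    RLIntegrable γ (fun τ => τ ^ (b - 1)) t ∧ rlIntegral γ (fun τ => τ ^ (b - 1)) t =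
      Real.Gamma b / Real.Gamma (b + γ) * t ^ (b + γ - 1) := by
  have hG1 := Real.Gamma_pos_of_pos hb
  have hG2 := Real.Gamma_pos_of_pos hγ
  have hG3 := Real.Gamma_pos_of_pos (add_pos hb hγ)
  have hval : ∫ τ in (0 : ℝ)..t, τ ^ (b - 1) / (t - τ) ^ (1 - γ) =
      t ^ (b + γ - 1) * (Real.Gamma b * Real.Gamma γ / Real.Gamma (b + γ)) := by
    have h1 := Complex.betaIntegral_scaled b γ ht
    have h2 := Complex.Gamma_mul_Gamma_eq_betaIntegral (s := b) (t := γ) (by simpa) (by simpa)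
    rw [← Complex.ofReal_add, Complex.Gamma_ofReal, Complex.Gamma_ofReal, Complex.Gamma_ofReal]
      at h2
    have h3 : Complex.betaIntegral b γ =
        ((Real.Gamma b * Real.Gamma γ / Real.Gamma (b + γ) : ℝ) : ℂ) := by
      have : (Real.Gamma (b + γ) : ℂ) ≠ 0 := by exact_mod_cast hG3.ne'
      push_cast
      rw [eq_div_iff this, h2]; ring
    have h4 : (∫ x in (0 : ℝ)..t, (x : ℂ) ^ ((b : ℂ) - 1) * ((t : ℂ) - x) ^ ((γ : ℂ) - 1)) =
        ((∫ τ in (0 : ℝ)..t, τ ^ (b - 1) / (t - τ) ^ (1 - γ) : ℝ) : ℂ) := by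
      rw [← intervalIntegral.integral_ofReal, intervalIntegral.integral_of_le ht.le,
        intervalIntegral.integral_of_le ht.le, integral_Ioc_eq_integral_Ioo,
        integral_Ioc_eq_integral_Ioo]
      refine setIntegral_congr_fun measurableSet_Ioo fun τ hτ => ?_
      have hτ0 : 0 ≤ τ := hτ.1.le
      have hτ1 : 0 ≤ t - τ := by linarith [hτ.2]
      rw [div_eq_mul_inv, ← Real.rpow_neg hτ1, show -(1 - γ) = γ - 1 by ring, Complex.ofReal_mul,
        Complex.ofReal_cpow hτ0, Complex.ofReal_cpow hτ1]
      push_cast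
      rfl
    have h5 : (t : ℂ) ^ ((b : ℂ) + γ - 1) = ((t ^ (b + γ - 1) : ℝ) : ℂ) := by
      rw [Complex.ofReal_cpow ht.le]; push_cast; rfl
    rw [h4, h3, h5, ← Complex.ofReal_mul] at h1
    exact_mod_cast h1
  refine ⟨?_, ?_⟩
  -- the integrand is integrable because its integral is not the junk value `0`
  · refine intervalIntegral.intervalIntegrable_of_integral_ne_zero ?_
    rw [hval]
    positivity
  · rw [rlIntegral, hval]
    field_simp

/-- The factor `1 / (1 - W(-2ζ; -α/2; 1))` of the similarity temperature. -/
noncomputable def simConst (α ζ : ℝ) : ℝ := 1 / (1 - wrightNeg (α / 2) 1 (2 * ζ))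

lemma simTemp_eq (α ζ x t : ℝ) :
    simTemp α ζ x t = 1 - simConst α ζ * (1 - wrightKernel (α / 2) 1 x t) := by
  rw [simTemp, simConst, wrightKernel, sub_self, Real.rpow_zero, one_mul, wrightNeg, wrightNeg,
    neg_mul]

lemma simFront_div {α ζ t : ℝ} (ht : 0 < t) : simFront α ζ t / t ^ (α / 2) = 2 * ζ := by
  have : t ^ (α / 2) ≠ 0 := by positivity
  rw [simFront, mul_div_cancel_right₀ _ this]

lemma wrightKernel_simFront {α ζ t : ℝ} (ht : 0 < t) (β : ℝ) :
    wrightKernel (α / 2) β (simFront α ζ t) t = t ^ (β - 1) * wrightNeg (α / 2) β (2 * ζ) := by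
  rw [wrightKernel, simFront_div ht]

lemma simFront_pos {α ζ t : ℝ} (hζ : 0 < ζ) (ht : 0 < t) : 0 < simFront α ζ t := by
  rw [simFront]; positivity

lemma hasDerivAt_simTemp_time {α : ℝ} (hα0 : 0 < α) (hα1 : α < 1) (ζ x : ℝ) {t : ℝ} (ht : 0 < t) :
    HasDerivAt (fun τ => simTemp α ζ x τ) (simConst α ζ * wrightKernel (α / 2) 0 x t) t := by
  simp only [simTemp_eq]
  have h := hasDerivAt_wrightKernel_time (ρ := α / 2) (by linarith) (by linarith) 1 x ht
  rw [sub_self] at h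
  refine (((h.const_sub 1).const_mul (simConst α ζ)).const_sub 1).congr_deriv ?_
  ring

lemma hasDerivAt_simTemp_space {α : ℝ} (hα0 : 0 < α) (hα1 : α < 1) (ζ x : ℝ) {t : ℝ} (ht : 0 < t) :
    HasDerivAt (fun z => simTemp α ζ z t)
      (-simConst α ζ * wrightKernel (α / 2) (1 - α / 2) x t) x := by
  simp only [simTemp_eq]
  have h := hasDerivAt_wrightKernel_space (ρ := α / 2) (by linarith) (by linarith) 1 x ht
  refine (((h.const_sub 1).const_mul (simConst α ζ)).const_sub 1).congr_deriv ?_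
  ring

lemma hasDerivAt_simFront {α : ℝ} (ζ : ℝ) {t : ℝ} (ht : 0 < t) :
    HasDerivAt (simFront α ζ) (2 * ζ * (α / 2) * t ^ (α / 2 - 1)) t := by
  refine ((Real.hasDerivAt_rpow_const (p := α / 2) (Or.inl ht.ne')).const_mul
    (2 * ζ)).congr_deriv ?_
  ring

lemma isStefanPair_sim {α ζ : ℝ} (hα0 : 0 < α) (hα1 : α < 1) (hζ : 0 < ζ) (T : ℝ) :
    IsStefanPair T (simTemp α ζ) (simFront α ζ) where
  front_continuous :=
    (continuous_const.mul (Real.continuous_rpow_const (by linarith))).continuousOn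
  front_zero := by rw [simFront, Real.zero_rpow (by linarith), mul_zero]
  front_pos t ht := simFront_pos hζ ht.1
  temp_continuous := by
    simp only [simTemp_eq]
    refine continuousOn_const.sub (continuousOn_const.mul (continuousOn_const.sub ?_))
    intro p hp
    have hp2 : 0 < p.2 := hp.1.1
    refine ContinuousAt.continuousWithinAt ?_
    simp only [wrightKernel, sub_self, Real.rpow_zero, one_mul]
    refine (continuous_wrightNeg (by linarith) (by linarith) 1).continuousAt.comp
      (ContinuousAt.div continuousAt_fst ?_ (by positivity))
    exact continuousAt_snd.rpow_const (Or.inl hp2.ne')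
  temp_fixed t _ := by
    rw [simTemp_eq, wrightKernel, zero_div, wrightNeg_one_zero]
    simp
  temp_front t ht := by
    have := wrightNeg_one_lt_one (ρ := α / 2) (y := 2 * ζ) (by linarith) (by linarith)
      (by linarith)
    have h0 : 1 - wrightNeg (α / 2) 1 (2 * ζ) ≠ 0 := by linarith
    rw [simTemp_eq, wrightKernel_simFront ht.1, simConst, sub_self, Real.rpow_zero, one_mul,
      one_div, inv_mul_cancel₀ h0, sub_self]

theorem solvesCaputoStefan_sim {α η : ℝ} (hα0 : 0 < α) (hα1 : α < 1) (hη : IsEtaRoot α η) (T : ℝ) :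
    SolvesCaputoStefan α T (simTemp α η) (simFront α η) where
  toIsStefanPair := isStefanPair_sim hα0 hα1 hη.1 T
  diffusion := by
    intro t ht x hx
    have hρ0 : 0 < α / 2 := by linarith
    have hρ : α / 2 < 1 / 2 := by linarith
    have hder : ∀ τ ∈ Ioo 0 t, deriv (fun τ => simTemp α η x τ) τ =
        simConst α η * wrightKernel (α / 2) 0 x τ := fun τ hτ =>
      (hasDerivAt_simTemp_time hα0 hα1 η x hτ.1).deriv
    refine ⟨simConst α η * wrightKernel (α / 2) (1 - α) x t, ⟨fun τ hτ => ?_, ?_, ?_⟩,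
      fun y _ => (hasDerivAt_simTemp_space hα0 hα1 η y ht.1).differentiableAt, ?_⟩
    · exact (hasDerivAt_simTemp_time hα0 hα1 η x hτ.1).differentiableAt
    · exact (rlIntegrable_wrightKernel hρ0 hρ one_pos (by linarith) hx.1 ht.1).const_mul_congr
        ht.1 hder
    · rw [rlIntegral_const_mul_congr ht.1 hder,
        rlIntegral_wrightKernel_zero hρ0 hρ (by linarith) (by linarith) hx.1 ht.1]
    · have e : (fun y => deriv (fun z => simTemp α η z t) y) =
          fun y => -simConst α η * wrightKernel (α / 2) (1 - α / 2) y t :=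
        funext fun y => (hasDerivAt_simTemp_space hα0 hα1 η y ht.1).deriv
      rw [e]
      refine ((hasDerivAt_wrightKernel_space hρ0 hρ (1 - α / 2) x ht.1).const_mul
        (-simConst α η)).congr_deriv ?_
      rw [show 1 - α / 2 - α / 2 = 1 - α by ring]
      ring
  stefan := by
    intro t ht
    have hρ0 : 0 < α / 2 := by linarith
    have hρ : α / 2 < 1 / 2 := by linarith
    have hder : ∀ τ ∈ Ioo 0 t, deriv (simFront α η) τ =
        2 * η * (α / 2) * (fun τ : ℝ => τ ^ (α / 2 - 1)) τ := fun τ hτ =>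
      (hasDerivAt_simFront η hτ.1).deriv
    obtain ⟨hint, hval⟩ := rlIntegral_rpow (b := α / 2) (γ := 1 - α) hρ0 (by linarith) ht.1
    refine ⟨_, ⟨fun τ hτ => (hasDerivAt_simFront η hτ.1).differentiableAt,
      hint.const_mul_congr ht.1 hder, rfl⟩, ?_⟩
    rw [rlIntegral_const_mul_congr ht.1 hder, hval]
    refine (hasDerivAt_simTemp_space hα0 hα1 η _ ht.1).hasDerivWithinAt.congr_deriv ?_
    obtain ⟨hη0, hη⟩ := isEtaRoot_iff.mp hη
    have hW := wrightNeg_one_lt_one hρ0 hρ (y := 2 * η) (by linarith)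
    have hW' : 1 - wrightNeg (α / 2) 1 (2 * η) ≠ 0 := by linarith
    have hG1 : Real.Gamma (1 - α / 2) ≠ 0 := (Real.Gamma_pos_of_pos (by linarith)).ne'
    have hG2 : Real.Gamma (α / 2) ≠ 0 := (Real.Gamma_pos_of_pos hρ0).ne'
    have hG3 : Real.Gamma (1 + α / 2) = α / 2 * Real.Gamma (α / 2) := by
      rw [add_comm]; exact Real.Gamma_add_one hρ0.ne'
    rw [wrightKernel_simFront ht.1, simConst, show α / 2 + (1 - α) = 1 - α / 2 by ring]
    rw [stefanLHS, hG3] at hη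
    have hη' : 2 * η * (1 - wrightNeg (α / 2) 1 (2 * η)) * (α / 2 * Real.Gamma (α / 2)) =
        wrightNeg (α / 2) (1 - α / 2) (2 * η) * Real.Gamma (1 - α / 2) := by
      rw [hη]; field_simp
    generalize t ^ (1 - α / 2 - 1) = P
    generalize Real.Gamma (1 - α / 2) = G at *
    generalize wrightNeg (α / 2) (1 - α / 2) (2 * η) = M at *
    generalize wrightNeg (α / 2) 1 (2 * η) = W at *
    rw [neg_mul, neg_inj, one_div, inv_mul_eq_iff_eq_mul₀ hW']
    refine mul_right_cancel₀ hG1 ?_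
    rw [mul_assoc, ← hη']
    field_simp

theorem solvesRLStefan_sim {α ξ : ℝ} (hα0 : 0 < α) (hα1 : α < 1) (hξ : IsXiRoot α ξ) (T : ℝ) :
    SolvesRLStefan α T (simTemp α ξ) (simFront α ξ) where
  toIsStefanPair := isStefanPair_sim hα0 hα1 hξ.1 T
  flux := by
    have hρ0 : 0 < α / 2 := by linarith
    have hρ : α / 2 < 1 / 2 := by linarith
    refine ⟨fun x t => -simConst α ξ * wrightKernel (α / 2) (α / 2) x t, ?_, ?_, ?_⟩
    · intro t ht x hx
      have hder : ∀ y, ∀ τ ∈ Ioo 0 y, deriv (fun z => simTemp α ξ z τ) x =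
          -simConst α ξ * wrightKernel (α / 2) (1 - α / 2) x τ := fun y τ hτ =>
        (hasDerivAt_simTemp_space hα0 hα1 ξ x hτ.1).deriv
      have hpos : ∀ᶠ y in 𝓝[Icc 0 T] t, 0 < y :=
        nhdsWithin_le_nhds (lt_mem_nhds ht.1)
      refine ⟨fun τ hτ => (hasDerivAt_simTemp_space hα0 hα1 ξ x hτ.1).differentiableAt, ?_, ?_⟩
      · filter_upwards [hpos] with y hy
        exact (rlIntegrable_wrightKernel hρ0 hρ (by linarith) (by linarith) hx.1 hy).const_mul_congr
          hy (hder y)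
      · have heq : ∀ y, 0 < y → rlIntegral (1 - (1 - α))
            (fun τ => deriv (fun z => simTemp α ξ z τ) x) y =
            -simConst α ξ * ∫ τ in (0 : ℝ)..y, wrightKernel (α / 2) (α / 2) x τ := by
          intro y hy
          rw [rlIntegral_const_mul_congr hy (hder y), ← rlIntegral_wrightKernel_one_sub hρ0 hρ hx.1 hy,
            show 1 - (1 - α) = 2 * (α / 2) by ring]
        have hint : IntervalIntegrable (wrightKernel (α / 2) (α / 2) x) volume 0 t := by
          have := rlIntegrable_wrightKernel (β := α / 2) (γ := 1) hρ0 hρ (by linarith) one_pos hx.1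
            ht.1
          simpa [RLIntegrable] using this
        have hc := continuousOn_wrightKernel hρ0 hρ (α / 2) x
        have hFTC := (intervalIntegral.integral_hasDerivAt_right hint
          (hc.stronglyMeasurableAtFilter isOpen_Ioi t ht.1)
          (hc.continuousAt (Ioi_mem_nhds ht.1))).const_mul (-simConst α ξ)
        refine hFTC.hasDerivWithinAt.congr_of_eventuallyEq ?_ (heq t ht.1)
        filter_upwards [hpos] with y hy
        exact heq y hy
    · intro t ht x hx
      refine ⟨_, hasDerivAt_simTemp_time hα0 hα1 ξ x ht.1, ?_⟩
      refine ((hasDerivAt_wrightKernel_space hρ0 hρ (α / 2) x ht.1).const_mul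
        (-simConst α ξ)).congr_deriv ?_
      rw [sub_self]
      ring
    · intro t ht
      refine ⟨_, (hasDerivAt_simFront ξ ht.1).hasDerivWithinAt, ?_⟩
      have hlim : Tendsto (fun x => -simConst α ξ * wrightKernel (α / 2) (α / 2) x t)
          (𝓝[<] (simFront α ξ t))
          (𝓝 (-simConst α ξ * wrightKernel (α / 2) (α / 2) (simFront α ξ t) t)) :=
        ((hasDerivAt_wrightKernel_space hρ0 hρ (α / 2) _ ht.1).continuousAt.const_mul
          (-simConst α ξ)).tendsto.mono_left nhdsWithin_le_nhds
      convert hlim using 2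
      obtain ⟨hξ0, hξ⟩ := isXiRoot_iff.mp hξ
      have hW := wrightNeg_one_lt_one hρ0 hρ (y := 2 * ξ) (by linarith)
      have hW' : 1 - wrightNeg (α / 2) 1 (2 * ξ) ≠ 0 := by linarith
      rw [wrightKernel_simFront ht.1, wrightNeg_self_eq hρ0 hρ, ← hξ, stefanLHS, simConst]
      field_simp

lemma simTemp_ne {α η ξ x t : ℝ} (hα0 : 0 < α) (hα1 : α < 1) (hη : 0 < η) (hξ : 0 < ξ)
    (hne : η ≠ ξ) (hx : 0 < x) (ht : 0 < t) : simTemp α η x t ≠ simTemp α ξ x t := by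
  have hρ0 : 0 < α / 2 := by linarith
  have hρ : α / 2 < 1 / 2 := by linarith
  intro h
  have h1 : 1 - wrightKernel (α / 2) 1 x t ≠ 0 := by
    have := wrightNeg_one_lt_one hρ0 hρ (y := x / t ^ (α / 2)) (by positivity)
    rw [wrightKernel, sub_self, Real.rpow_zero, one_mul]
    linarith
  rw [simTemp_eq, simTemp_eq, sub_right_inj, mul_left_inj' h1, simConst, simConst, one_div,
    one_div, inv_inj, sub_right_inj] at h
  have := (strictAntiOn_wrightNeg_one hρ0 hρ).injOn (mem_Ici.mpr (by linarith))
    (mem_Ici.mpr (by linarith)) h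
  exact hne (by linarith)

lemma simFront_ne {α η ξ t : ℝ} (hne : η ≠ ξ) (ht : 0 < t) : simFront α η t ≠ simFront α ξ t := by
  have h0 : t ^ (α / 2) ≠ 0 := by positivity
  intro h
  rw [simFront, simFront, mul_left_inj' h0] at h
  exact hne (by linarith)

end FracStefan

theorem theorem1 (α : ℝ) (hα0 : 0 < α) (hα1 : α < 1) :
    ∃ η ξ : ℝ,
      -- `η` and `ξ` are the unique positive roots of their equations
      (FracStefan.IsEtaRoot α η ∧ ∀ y : ℝ, FracStefan.IsEtaRoot α y → y = η) ∧
      (FracStefan.IsXiRoot α ξ ∧ ∀ y : ℝ, FracStefan.IsXiRoot α y → y = ξ) ∧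
      -- the two explicit pairs solve the two problems on every time interval
      (∀ T : ℝ, 0 < T →
        FracStefan.SolvesCaputoStefan α T (FracStefan.simTemp α η) (FracStefan.simFront α η)) ∧
      (∀ T : ℝ, 0 < T →
        FracStefan.SolvesRLStefan α T (FracStefan.simTemp α ξ) (FracStefan.simFront α ξ)) ∧
      -- the two solutions are different
      η ≠ ξ ∧
      (∀ t : ℝ, 0 < t → FracStefan.simFront α η t ≠ FracStefan.simFront α ξ t) ∧
      (∀ x t : ℝ, 0 < x → 0 < t → FracStefan.simTemp α η x t ≠ FracStefan.simTemp α ξ x t) := by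
  obtain ⟨η, hη, hηu⟩ := FracStefan.existsUnique_isEtaRoot hα0 hα1
  obtain ⟨ξ, hξ, hξu⟩ := FracStefan.existsUnique_isXiRoot hα0 hα1
  have hne : η ≠ ξ := FracStefan.isEtaRoot_ne_isXiRoot hα0 hα1 hη hξ
  exact ⟨η, ξ, ⟨hη, hηu⟩, ⟨hξ, hξu⟩,
    fun T _ => FracStefan.solvesCaputoStefan_sim hα0 hα1 hη T,
    fun T _ => FracStefan.solvesRLStefan_sim hα0 hα1 hξ T, hne,
    fun t ht => FracStefan.simFront_ne hne ht,
    fun x t hx ht => FracStefan.simTemp_ne hα0 hα1 hη.1 hξ.1 hne hx ht⟩
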